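/- Let $(H,\omega)$ be a real symplectic vector space of finite dimension $2n$ (so $\omega$ is a nondegenerate alternating bilinear form on $H$), and let $$\mathit{Sp}^{**}(H) = \{A \in \mathit{Sp}(H) : \pm 1 \notin \mathrm{spec}(A)\}$$ be the set of linear symplectic automorphisms of $H$ not having $1$ or $-1$ as an eigenvalue, with the subspace topology from $\mathrm{End}(H)$. For $A \in \mathit{Sp}^{**}(H)$, let $E \subset H_{\mathbb C} = H \otimes_{\mathbb R} \mathbb C$ be the direct sum of the generalized eigenspaces of $A$ for all eigenvalues $\lambda$ with $|\lambda|^2 = 1$ and $\mathrm{im}(\lambda) > 0$. The Krein index $\kappa(A) \in \mathbb Z$ is the signature (the maximal dimension of a positive definite complex subspace minus the maximal dimension of a negative definite one) of the hermitian form $\langle h_1,h_2\rangle = i\,\omega(\bar h_1,h_2)$ on $E$, where $\omega$ is extended complex bilinearly to $H_{\mathbb C}$. Then $A \mapsto (\mathrm{sign}(\det(I-A)), \kappa(A))$ induces a well-defined map $$\pi_0(\mathit{Sp}^{**}(H)) \longrightarrow \{\pm 1\} \times \mathbb Z$$ on the set of connected components of $\mathit{Sp}^{**}(H)$. This map is injective,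 and its image is exactly the set of pairs $(s,k) \in \{\pm1\} \times \mathbb Z$ such that $|k| \le n$ if $s = 1$, and $|k| \le n-1$ if $s = -1$. -/

import Mathlib

open scoped TensorProduct

noncomputable section

/-- The linear symplectic group `Sp(H)` of a symplectic vector space `(H, ω)`, as a set of linear
endomorphisms: those preserving `ω` (they are invertible since `ω` is nondegenerate and `H` is
finite-dimensional). -/
def Sp {H : Type*} [AddCommGroup H] [Module ℝ H] (ω : LinearMap.BilinForm ℝ H) :
    Set (Module.End ℝ H) :=
  {A | ∀ x y, ω (A x) (A y) = ω x y}

/-- `Sp^{**}(H)`: the symplectic automorphisms which do not have `1` or `-1` as eigenvalues. -/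
def SpStarStar {H : Type*} [AddCommGroup H] [Module ℝ H] (ω : LinearMap.BilinForm ℝ H) : Type _ :=
  {A : Module.End ℝ H // A ∈ Sp ω ∧ (1 : ℝ) ∉ spectrum ℝ A ∧ (-1 : ℝ) ∉ spectrum ℝ A}

/-- The topology of `Sp^{**}(H)` is the subspace topology from `End(H)`, where the real vector space
`End(H)` has its module topology. When `H` is finite-dimensional, this is the usual (unique
Hausdorff vector space) topology of `End(H)`. -/
instance {H : Type*} [AddCommGroup H] [Module ℝ H] (ω : LinearMap.BilinForm ℝ H) :
    TopologicalSpace (SpStarStar ω) :=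
  TopologicalSpace.induced (fun A => A.1) (moduleTopology ℝ (Module.End ℝ H))

/-- Complex conjugation `h ↦ h̄` on the complexification `H_ℂ = ℂ ⊗ H`. -/
def conjC (H : Type*) [AddCommGroup H] [Module ℝ H] : ℂ ⊗[ℝ] H →ₗ[ℝ] ℂ ⊗[ℝ] H :=
  LinearMap.rTensor H Complex.conjAe.toLinearMap

/-- The hermitian form `⟨h₁, h₂⟩ = i ω(h̄₁, h₂)` on `H_ℂ`, where `ω` is extended complex
bilinearly. -/
def kreinForm {H : Type*} [AddCommGroup H] [Module ℝ H] (ω : LinearMap.BilinForm ℝ H)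
    (h₁ h₂ : ℂ ⊗[ℝ] H) : ℂ :=
  Complex.I * (LinearMap.BilinForm.baseChange ℂ ω) (conjC H h₁) h₂

/-- The sum `E ⊆ H_ℂ` of all generalized eigenspaces of `A` for the eigenvalues `z` with
`|z|² = 1` and `im z > 0`. -/
def kreinSpace {H : Type*} [AddCommGroup H] [Module ℝ H] (A : Module.End ℝ H) :
    Submodule ℂ (ℂ ⊗[ℝ] H) :=
  ⨆ z ∈ {z : ℂ | ‖z‖ ^ 2 = 1 ∧ 0 < z.im},
    Module.End.maxGenEigenspace (LinearMap.baseChange ℂ A : Module.End ℂ (ℂ ⊗[ℝ] H)) z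

/-- The positive index of inertia on the complex subspace `E` of a hermitian form `b`: the largest
dimension of a complex subspace of `E` on which `b` is positive definite. -/
def posInertia {V : Type*} [AddCommGroup V] [Module ℂ V] (E : Submodule ℂ V) (b : V → V → ℂ) : ℕ :=
  sSup {d | ∃ W : Submodule ℂ V, W ≤ E ∧ Module.finrank ℂ W = d ∧
    ∀ h ∈ W, h ≠ 0 → 0 < (b h h).re}

/-- The Krein index `κ(A)`: the signature (positive minus negative index of inertia) of the
hermitian form `i ω(h̄₁, h₂)` on `E`. -/
def kreinIndex {H : Type*} [AddCommGroup H] [Module ℝ H] (ω : LinearMap.BilinForm ℝ H)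
    (A : Module.End ℝ H) : ℤ :=
  (posInertia (kreinSpace A) (kreinForm ω) : ℤ) -
    (posInertia (kreinSpace A) (fun h₁ h₂ => -kreinForm ω h₁ h₂) : ℤ)

end

open scoped TensorProduct ComplexConjugate
open Module Filter Topology

/-!
The Cayley transform `A = -(1 + X)(1 - X)⁻¹` identifies `Sp^{**}(H)` with the set of invertible
`X ∈ 𝔰𝔭(ω)` without the eigenvalue `1`. It preserves the sign of `det (1 - A)`, and `2κ(A)` becomes
the signature of the real quadratic form `ω(Xx, x)`: on the part `E` of the spectrum of `X` in
`-iℝ_{>0}`, the hermitian forms `iω` and `ω(X·, ·)` are joined by a homotopy of nondegenerate forms,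
complex conjugation carries `E` to the part in `iℝ_{>0}`, and the rest of the spectrum contributes
a sum of two isotropic subspaces.

For path components, if `X` has no real eigenvalue `≥ 1`, then `X` can be shrunk to `εX`, where
only invertibility matters, and invertible forms of a given signature are path-connected by
Sylvester's law. Eigenvalue pairs `±μ` with `μ > 1` split off as hyperbolic planes. Two such planes
merge into a complex quadruple that can move around `1`, so at most one plane is left, and it is
left exactly when `det (1 - X) < 0`.
-/

section HermitianInertia

variable {V : Type*} [AddCommGroup V] [Module ℂ V]

/-- The sesquilinear form `b` is nondegenerate on the subspace `E`. -/
def NondegenerateOn (b : V →ₗ⋆[ℂ] V →ₗ[ℂ] ℂ) (E : Submodule ℂ V) : Prop :=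
  ∀ x ∈ E, (∀ y ∈ E, b x y = 0) → x = 0

/-- The sesquilinear form `b` is positive definite on the subspace `W`. -/
def PosDefOn (b : V →ₗ⋆[ℂ] V →ₗ[ℂ] ℂ) (W : Submodule ℂ V) : Prop :=
  ∀ x ∈ W, x ≠ 0 → 0 < (b x x).re

/-- `P` and `N` are subspaces of `E` of complementary dimensions on which `b` is positive definite
and negative definite, respectively. -/
structure IsDefiniteSplitting (b : V →ₗ⋆[ℂ] V →ₗ[ℂ] ℂ) (E P N : Submodule ℂ V) : Prop where
  pos_le : P ≤ E
  neg_le : N ≤ E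
  pos : PosDefOn b P
  neg : PosDefOn (-b) N
  finrank_add_finrank : finrank ℂ P + finrank ℂ N = finrank ℂ E

/-- The signature on `E` of the hermitian form `b`. -/
noncomputable def hermitianSignature (E : Submodule ℂ V) (b : V →ₗ⋆[ℂ] V →ₗ[ℂ] ℂ) : ℤ :=
  posInertia E (fun x y => b x y) - posInertia E (fun x y => (-b) x y)

variable {b : V →ₗ⋆[ℂ] V →ₗ[ℂ] ℂ} {E F P P' N N' W : Submodule ℂ V}

theorem posDefOn_bot : PosDefOn b ⊥ := fun _ hx hx0 => (hx0 ((Submodule.mem_bot ℂ).1 hx)).elim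

theorem posDefOn_span_singleton {v : V} (hv : 0 < (b v v).re) :
    PosDefOn b (Submodule.span ℂ {v}) := by
  intro x hx hx0
  obtain ⟨c, rfl⟩ := Submodule.mem_span_singleton.1 hx
  have hc : c ≠ 0 := by rintro rfl; exact hx0 (zero_smul _ _)
  have hcv : b (c • v) (c • v) = (Complex.normSq c : ℂ) * b v v := by
    rw [map_smul, map_smulₛₗ, LinearMap.smul_apply, smul_eq_mul, smul_eq_mul, ← mul_assoc,
      Complex.mul_conj]
  rw [hcv, Complex.re_ofReal_mul]
  exact mul_pos (Complex.normSq_pos.2 hc) hv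

theorem PosDefOn.sup (hE : PosDefOn b E) (hF : PosDefOn b F) (hEF : ∀ x ∈ E, ∀ y ∈ F, b x y = 0)
    (hFE : ∀ x ∈ F, ∀ y ∈ E, b x y = 0) : PosDefOn b (E ⊔ F) := by
  intro z hz hz0
  obtain ⟨x, hx, y, hy, rfl⟩ := Submodule.mem_sup.1 hz
  have hxy : (b (x + y) (x + y)).re = (b x x).re + (b y y).re := by
    simp only [map_add, LinearMap.add_apply, hEF x hx y hy, hFE y hy x hx, zero_add, add_zero,
      Complex.add_re]
  rw [hxy]
  rcases eq_or_ne x 0 with rfl | hx0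
  · simpa using hF y hy (by simpa using hz0)
  rcases eq_or_ne y 0 with rfl | hy0
  · simpa using hE x hx hx0
  exact add_pos (hE x hx hx0) (hF y hy hy0)

theorem PosDefOn.disjoint_of_isotropic (hW : PosDefOn b W) (hE : ∀ x ∈ E, b x x = 0) :
    Disjoint W E := by
  refine Submodule.disjoint_def.2 fun x hxW hxE => by_contra fun hx0 => ?_
  simpa [hE x hxE] using hW x hxW hx0

theorem PosDefOn.disjoint_neg (hP : PosDefOn b P) (hN : PosDefOn (-b) N) : Disjoint P N := by
  refine Submodule.disjoint_def.2 fun x hxP hxN => by_contra fun hx0 => ?_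
  have hneg := hN x hxN hx0
  rw [LinearMap.neg_apply, LinearMap.neg_apply, Complex.neg_re] at hneg
  linarith [hP x hxP hx0]

theorem NondegenerateOn.of_sup (h : NondegenerateOn b (E ⊔ F))
    (hEF : ∀ x ∈ E, ∀ y ∈ F, b x y = 0) : NondegenerateOn b E := by
  refine fun x hx hxE => h x (Submodule.mem_sup_left hx) fun z hz => ?_
  obtain ⟨y, hy, y', hy', rfl⟩ := Submodule.mem_sup.1 hz
  rw [map_add, hxE y hy, hEF x hx y' hy', add_zero]

theorem apply_eq_zero_symm (hb : b.IsSymm) {x y : V} (h : b x y = 0) : b y x = 0 := by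
  rw [← hb.eq, h, map_zero]

theorem exists_apply_self_re_ne_zero (hb : b.IsSymm) (hE : NondegenerateOn b E) (hE0 : E ≠ ⊥) :
    ∃ x ∈ E, (b x x).re ≠ 0 := by
  by_contra! h
  obtain ⟨x, hx, hx0⟩ := Submodule.exists_mem_ne_zero_of_ne_bot hE0
  refine hx0 (hE x hx fun y hy => ?_)
  set z := b x y with hz
  have hyx : b y x = conj z := (hb.eq x y).symm
  have hsum := h (x + conj z • y) (E.add_mem hx (E.smul_mem _ hy))
  have hsmul := h (conj z • y) (E.smul_mem _ hy)
  simp only [map_add, map_smulₛₗ, LinearMap.add_apply, LinearMap.smul_apply, ← hz, hyx,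
    smul_eq_mul, RingHom.id_apply, Complex.conj_conj, mul_add, Complex.add_re, h x hx,
    Complex.mul_conj, mul_comm (conj z) z, Complex.ofReal_re] at hsum hsmul
  exact Complex.normSq_eq_zero.1 (by linarith)

theorem IsDefiniteSplitting.swap (h : IsDefiniteSplitting b E P N) :
    IsDefiniteSplitting (-b) E N P where
  pos_le := h.neg_le
  neg_le := h.pos_le
  pos := h.neg
  neg := by rw [neg_neg]; exact h.pos
  finrank_add_finrank := by rw [add_comm, h.finrank_add_finrank]

theorem exists_isDefiniteSplitting_span_singleton {v : V} (hv : (b v v).re ≠ 0) :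
    ∃ P N, IsDefiniteSplitting b (Submodule.span ℂ {v}) P N := by
  rcases hv.lt_or_gt with hneg | hpos
  · refine ⟨⊥, _, bot_le, le_rfl, posDefOn_bot, posDefOn_span_singleton ?_, by simp⟩
    simpa using hneg
  · exact ⟨_, ⊥, le_rfl, bot_le, posDefOn_span_singleton hpos, posDefOn_bot, by simp⟩

theorem span_singleton_sup_ker_inf {v : V} (hv : v ∈ E) (hvv : b v v ≠ 0) :
    Submodule.span ℂ {v} ⊔ LinearMap.ker (b v) ⊓ E = E := by
  refine le_antisymm (sup_le ((Submodule.span_singleton_le_iff_mem _ _).2 hv) inf_le_right) ?_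
  intro x hx
  have hker : x - (b v x / b v v) • v ∈ LinearMap.ker (b v) := by
    rw [LinearMap.mem_ker, map_sub, map_smul, smul_eq_mul, div_mul_cancel₀ _ hvv, sub_self]
  exact Submodule.mem_sup.2 ⟨_, Submodule.smul_mem _ _ (Submodule.mem_span_singleton_self v), _,
    ⟨hker, E.sub_mem hx (E.smul_mem _ hv)⟩, add_sub_cancel _ _⟩

variable [FiniteDimensional ℂ V]

theorem finrank_sup_of_disjoint (h : Disjoint E F) :
    finrank ℂ (E ⊔ F : Submodule ℂ V) = finrank ℂ E + finrank ℂ F := by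
  have := Submodule.finrank_sup_add_finrank_inf_eq E F
  rwa [h.eq_bot, finrank_bot, add_zero] at this

theorem finrank_add_le_of_disjoint (hPE : P ≤ E) (hNE : N ≤ E) (h : Disjoint P N) :
    finrank ℂ P + finrank ℂ N ≤ finrank ℂ E := by
  rw [← finrank_sup_of_disjoint h]
  exact Submodule.finrank_mono (sup_le hPE hNE)

namespace IsDefiniteSplitting

theorem posInertia_eq (h : IsDefiniteSplitting b E P N) :
    posInertia E (fun x y => b x y) = finrank ℂ P := by
  refine IsGreatest.csSup_eq ⟨⟨P, h.pos_le, rfl, h.pos⟩, ?_⟩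
  rintro _ ⟨W, hWE, rfl, hW⟩
  have hWN := finrank_add_le_of_disjoint hWE h.neg_le (PosDefOn.disjoint_neg hW h.neg)
  have := h.finrank_add_finrank
  omega

theorem hermitianSignature_eq (h : IsDefiniteSplitting b E P N) :
    hermitianSignature E b = finrank ℂ P - finrank ℂ N := by
  rw [hermitianSignature, h.posInertia_eq, h.swap.posInertia_eq]

theorem sup (h : IsDefiniteSplitting b E P N) (h' : IsDefiniteSplitting b F P' N')
    (hdisj : Disjoint E F) (hEF : ∀ x ∈ E, ∀ y ∈ F, b x y = 0)
    (hFE : ∀ x ∈ F, ∀ y ∈ E, b x y = 0) :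
    IsDefiniteSplitting b (E ⊔ F) (P ⊔ P') (N ⊔ N') where
  pos_le := sup_le_sup h.pos_le h'.pos_le
  neg_le := sup_le_sup h.neg_le h'.neg_le
  pos := h.pos.sup h'.pos (fun x hx y hy => hEF x (h.pos_le hx) y (h'.pos_le hy))
    fun x hx y hy => hFE x (h'.pos_le hx) y (h.pos_le hy)
  neg := h.neg.sup h'.neg
    (fun x hx y hy => neg_eq_zero.2 (hEF x (h.neg_le hx) y (h'.neg_le hy)))
    fun x hx y hy => neg_eq_zero.2 (hFE x (h'.neg_le hx) y (h.neg_le hy))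
  finrank_add_finrank := by
    rw [finrank_sup_of_disjoint (hdisj.mono h.pos_le h'.pos_le),
      finrank_sup_of_disjoint (hdisj.mono h.neg_le h'.neg_le), finrank_sup_of_disjoint hdisj,
      ← h.finrank_add_finrank, ← h'.finrank_add_finrank]
    ring

end IsDefiniteSplitting

theorem exists_isDefiniteSplitting (hb : b.IsSymm) (hE : NondegenerateOn b E) :
    ∃ P N, IsDefiniteSplitting b E P N := by
  induction hd : finrank ℂ E using Nat.strong_induction_on generalizing E with
  | _ d ih =>
    rcases eq_or_ne E ⊥ with rfl | hE0
    · exact ⟨⊥, ⊥, le_rfl, le_rfl, posDefOn_bot, posDefOn_bot, by simp⟩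
    obtain ⟨v, hvE, hv⟩ := exists_apply_self_re_ne_zero hb hE hE0
    have hvv : b v v ≠ 0 := fun h => hv (by rw [h, Complex.zero_re])
    set L := Submodule.span ℂ {v}
    set F := LinearMap.ker (b v) ⊓ E
    have hsup : L ⊔ F = E := span_singleton_sup_ker_inf hvE hvv
    have hLF : ∀ x ∈ L, ∀ y ∈ F, b x y = 0 := by
      intro x hx y hy
      obtain ⟨c, rfl⟩ := Submodule.mem_span_singleton.1 hx
      rw [map_smulₛₗ, LinearMap.smul_apply, LinearMap.mem_ker.1 hy.1, smul_zero]
    have hFL : ∀ x ∈ F, ∀ y ∈ L, b x y = 0 := fun x hx y hy => apply_eq_zero_symm hb (hLF y hy x hx)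
    have hFd : finrank ℂ F < d := by
      rw [← hd]
      refine Submodule.finrank_lt_finrank_of_lt (lt_of_le_of_ne inf_le_right fun h => hvv ?_)
      exact LinearMap.mem_ker.1 (h.ge hvE).1
    have hdisj : Disjoint L F := by
      refine Submodule.disjoint_def.2 fun x hxL hxF => ?_
      obtain ⟨c, rfl⟩ := Submodule.mem_span_singleton.1 hxL
      have hc := LinearMap.mem_ker.1 hxF.1
      rw [map_smul, smul_eq_mul, mul_eq_zero, or_iff_left hvv] at hc
      rw [hc, zero_smul]
    obtain ⟨P, N, hPN⟩ := exists_isDefiniteSplitting_span_singleton hv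
    obtain ⟨P', N', hPN'⟩ := ih _ hFd ((sup_comm L F ▸ hsup.symm ▸ hE).of_sup hFL) rfl
    exact ⟨_, _, hsup ▸ hPN.sup hPN' hdisj hLF hFL⟩

theorem hermitianSignature_sup (hb : b.IsSymm) (hEF : ∀ x ∈ E, ∀ y ∈ F, b x y = 0)
    (hdisj : Disjoint E F) (hnd : NondegenerateOn b (E ⊔ F)) :
    hermitianSignature (E ⊔ F) b = hermitianSignature E b + hermitianSignature F b := by
  have hFE : ∀ x ∈ F, ∀ y ∈ E, b x y = 0 := fun x hx y hy => apply_eq_zero_symm hb (hEF y hy x hx)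
  obtain ⟨P, N, h⟩ := exists_isDefiniteSplitting hb (hnd.of_sup hEF)
  obtain ⟨P', N', h'⟩ := exists_isDefiniteSplitting hb ((sup_comm E F ▸ hnd).of_sup hFE)
  have hsup := h.sup h' hdisj hEF hFE
  rw [h.hermitianSignature_eq, h'.hermitianSignature_eq, hsup.hermitianSignature_eq,
    finrank_sup_of_disjoint (hdisj.mono h.pos_le h'.pos_le),
    finrank_sup_of_disjoint (hdisj.mono h.neg_le h'.neg_le)]
  push_cast
  ring

theorem hermitianSignature_sup_eq_zero_of_isotropic (hb : b.IsSymm) (hE : ∀ x ∈ E, b x x = 0)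
    (hF : ∀ x ∈ F, b x x = 0) (hnd : NondegenerateOn b (E ⊔ F)) :
    hermitianSignature (E ⊔ F) b = 0 := by
  obtain ⟨P, N, h⟩ := exists_isDefiniteSplitting hb hnd
  have hE' : ∀ x ∈ E, (-b) x x = 0 := fun x hx => neg_eq_zero.2 (hE x hx)
  have hF' : ∀ x ∈ F, (-b) x x = 0 := fun x hx => neg_eq_zero.2 (hF x hx)
  have hPE := finrank_add_le_of_disjoint h.pos_le le_sup_left (h.pos.disjoint_of_isotropic hE)
  have hPF := finrank_add_le_of_disjoint h.pos_le le_sup_right (h.pos.disjoint_of_isotropic hF)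
  have hNE := finrank_add_le_of_disjoint h.neg_le le_sup_left (h.neg.disjoint_of_isotropic hE')
  have hNF := finrank_add_le_of_disjoint h.neg_le le_sup_right (h.neg.disjoint_of_isotropic hF')
  have hle := Submodule.finrank_add_le_finrank_add_finrank E F
  have hPN := h.finrank_add_finrank
  rw [h.hermitianSignature_eq]
  omega

section Continuity

variable {T : Type*} [TopologicalSpace T] {b : T → V →ₗ⋆[ℂ] V →ₗ[ℂ] ℂ}

omit [FiniteDimensional ℂ V] in
theorem continuous_apply_linearCombination {ι : Type*} [Fintype ι]
    (hc : ∀ x y, Continuous fun t => b t x y) (v : ι → V) :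
    Continuous fun p : T × (ι → ℂ) =>
      b p.1 (Fintype.linearCombination ℂ v p.2) (Fintype.linearCombination ℂ v p.2) := by
  simp only [Fintype.linearCombination_apply, map_sum, map_smulₛₗ, LinearMap.sum_apply,
    LinearMap.smul_apply, smul_eq_mul, RingHom.id_apply]
  refine continuous_finsetSum _ fun i _ => Continuous.mul (by fun_prop) ?_
  refine continuous_finsetSum _ fun j _ => Continuous.mul ?_ ?_
  · exact Complex.continuous_conj.comp ((continuous_apply j).comp continuous_snd)
  · exact (hc (v j) (v i)).comp continuous_fst

theorem PosDefOn.eventually (hc : ∀ x y, Continuous fun t => b t x y) {t₀ : T}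
    (hW : PosDefOn (b t₀) W) : ∀ᶠ t in 𝓝 t₀, PosDefOn (b t) W := by
  let B := finBasis ℂ W
  let v : (Fin (finrank ℂ W) → ℂ) →ₗ[ℂ] V := Fintype.linearCombination ℂ fun i => (B i : V)
  have hv : ∀ x : W, v (B.equivFun x) = x := fun x => by
    simpa only [v, Fintype.linearCombination_apply, Submodule.coe_sum, Submodule.coe_smul] using
      congrArg Subtype.val (B.sum_equivFun x)
  have hsphere : ∀ᶠ t in 𝓝 t₀, ∀ c ∈ Metric.sphere (0 : Fin (finrank ℂ W) → ℂ) 1,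
      0 < (b t (v c) (v c)).re := by
    refine (isCompact_sphere _ _).eventually_forall_of_forall_eventually fun c hc1 => ?_
    have hc0 : B.equivFun.symm c ≠ 0 := by
      rw [Ne, EmbeddingLike.map_eq_zero_iff]
      rintro rfl
      simp at hc1
    have hpos := hW _ (B.equivFun.symm c).2 fun h => hc0 (Subtype.ext h)
    rw [← hv, LinearEquiv.apply_symm_apply] at hpos
    exact (Complex.continuous_re.comp
      (continuous_apply_linearCombination hc _)).continuousAt.eventually (lt_mem_nhds hpos)
  filter_upwards [hsphere] with t ht x hx hx0
  set c := B.equivFun ⟨x, hx⟩ with hc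
  have hc0 : c ≠ 0 := by simpa [hc] using hx0
  have hx_eq : x = (‖c‖ : ℂ) • v ((‖c‖ : ℂ)⁻¹ • c) := by
    rw [map_smul, smul_inv_smul₀ (by simpa using hc0), hc, hv]
  have hunit : (‖c‖ : ℂ)⁻¹ • c ∈ Metric.sphere (0 : Fin (finrank ℂ W) → ℂ) 1 := by
    simp [norm_smul, hc0]
  rw [hx_eq]
  refine posDefOn_span_singleton (ht _ hunit) _
    (Submodule.smul_mem _ _ (Submodule.mem_span_singleton_self _)) ?_
  rwa [← hx_eq]

theorem isLocallyConstant_hermitianSignature (hb : ∀ t, (b t).IsSymm)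
    (hc : ∀ x y, Continuous fun t => b t x y) (hnd : ∀ t, NondegenerateOn (b t) E) :
    IsLocallyConstant fun t => hermitianSignature E (b t) := by
  refine (IsLocallyConstant.iff_eventually_eq _).2 fun t₀ => ?_
  obtain ⟨P, N, h⟩ := exists_isDefiniteSplitting (hb t₀) (hnd t₀)
  filter_upwards [h.pos.eventually hc, h.neg.eventually (b := fun t => -b t)
    fun x y => (hc x y).neg] with t hP hN
  have ht : IsDefiniteSplitting (b t) E P N := { h with pos := hP, neg := hN }
  rw [h.hermitianSignature_eq, ht.hermitianSignature_eq]

end Continuity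

end HermitianInertia

section SpectralSum

variable {V : Type*} [AddCommGroup V] [Module ℂ V] {f g : End ℂ V} {s t : Set ℂ}

/-- The sum of the generalized eigenspaces of `f` for the eigenvalues in `s`. -/
def spectralSum (f : End ℂ V) (s : Set ℂ) : Submodule ℂ V :=
  ⨆ z ∈ s, f.maxGenEigenspace z

theorem spectralSum_le {W : Submodule ℂ V} (h : ∀ z ∈ s, f.maxGenEigenspace z ≤ W) :
    spectralSum f s ≤ W :=
  iSup₂_le h

theorem maxGenEigenspace_le_spectralSum (f : End ℂ V) {z : ℂ} (hz : z ∈ s) :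
    f.maxGenEigenspace z ≤ spectralSum f s :=
  le_iSup₂_of_le z hz le_rfl

theorem spectralSum_union (f : End ℂ V) (s t : Set ℂ) :
    spectralSum f (s ∪ t) = spectralSum f s ⊔ spectralSum f t :=
  iSup_union

theorem apply_mem_spectralSum {x : V} (hx : x ∈ spectralSum f s) : f x ∈ spectralSum f s :=
  (spectralSum_le fun z hz _ hy => maxGenEigenspace_le_spectralSum f hz
    (Module.End.mapsTo_maxGenEigenspace_of_comm (Commute.refl f) z hy) :
    spectralSum f s ≤ (spectralSum f s).comap f) hx

theorem disjoint_spectralSum (f : End ℂ V) (hst : Disjoint s t) :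
    Disjoint (spectralSum f s) (spectralSum f t) :=
  f.independent_maxGenEigenspace.disjoint_biSup_biSup hst

theorem mem_of_eigenvector_mem_spectralSum {x : V} {z : ℂ}
    (hx : x ∈ spectralSum f s) (hx0 : x ≠ 0) (hfx : f x = z • x) : z ∈ s := by
  by_contra hz
  have hxz : x ∈ spectralSum f {z} := maxGenEigenspace_le_spectralSum f (Set.mem_singleton z)
    (Module.End.eigenspace_le_maxGenEigenspace (Module.End.mem_eigenspace_iff.2 hfx))
  exact hx0 (Submodule.disjoint_def.1
    (disjoint_spectralSum f (Set.disjoint_singleton_right.2 hz)) x hx hxz)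

theorem spectralSum_eq_top [FiniteDimensional ℂ V] (h : ∀ z, f.HasEigenvalue z → z ∈ s) :
    spectralSum f s = ⊤ := by
  refine top_le_iff.1 (f.iSup_maxGenEigenspace_eq_top.ge.trans (iSup_le fun z => ?_))
  by_cases hz : f.HasEigenvalue z
  · exact maxGenEigenspace_le_spectralSum f (h z hz)
  · have hbot : f.maxGenEigenspace z = ⊥ := by
      by_contra hne
      exact hz ((Module.End.hasUnifEigenvalue_iff_hasUnifEigenvalue_one ENat.top_pos).1 hne)
    exact hbot ▸ bot_le

theorem spectralSum_sup_compl [FiniteDimensional ℂ V] (f : End ℂ V) (s : Set ℂ) :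
    spectralSum f s ⊔ spectralSum f sᶜ = ⊤ := by
  rw [← spectralSum_union, Set.union_compl_self]
  exact spectralSum_eq_top fun z _ => Set.mem_univ z

theorem maxGenEigenspace_eq_of_mul_sub_eq_smul_sub {u : End ℂ V} (hu : Function.Injective u)
    (huf : Commute u f) {z w c : ℂ} (hc : c ≠ 0) (h : u * (f - z • 1) = c • (g - w • 1)) :
    f.maxGenEigenspace z = g.maxGenEigenspace w := by
  have hcomm : Commute u (f - z • 1) := huf.sub_right ((Commute.one_right u).smul_right z)
  ext x
  rw [Module.End.mem_maxGenEigenspace, Module.End.mem_maxGenEigenspace]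
  refine exists_congr fun k => ?_
  have hpow : (u ^ k) (((f - z • 1) ^ k) x) = c ^ k • ((g - w • 1) ^ k) x := by
    rw [← Module.End.mul_apply, ← hcomm.mul_pow, h, smul_pow, LinearMap.smul_apply]
  have huk : Function.Injective (u ^ k) := by
    rw [Module.End.coe_pow]
    exact hu.iterate k
  rw [← map_eq_zero_iff _ huk, hpow, smul_eq_zero_iff_right (pow_ne_zero k hc)]

theorem apply_eq_zero_of_forall_apply_add_smul_eq_zero {φ : V →ₗ[ℂ] ℂ} {c z : ℂ} (hcz : c + z ≠ 0)
    (hφ : ∀ y ∈ f.maxGenEigenspace z, φ (f y + c • y) = 0) {y : V}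
    (hy : y ∈ f.maxGenEigenspace z) : φ y = 0 := by
  obtain ⟨k, hk⟩ := (Module.End.mem_maxGenEigenspace f z y).1 hy
  induction k generalizing y with
  | zero => rw [show y = 0 from hk, map_zero]
  | succ k ih =>
    have hy' : (f - z • 1) y ∈ f.maxGenEigenspace z :=
      Module.End.mapsTo_maxGenEigenspace_of_comm
        ((Commute.refl f).sub_right ((Commute.one_right f).smul_right z)) z hy
    have hφy' := ih hy' (by rw [← Module.End.mul_apply, ← pow_succ, hk])
    have hsplit : f y + c • y = (f - z • 1) y + (c + z) • y := by
      simp only [LinearMap.sub_apply, LinearMap.smul_apply, Module.End.one_apply]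
      module
    have := hφ y hy
    rw [hsplit, map_add, hφy', zero_add, map_smul, smul_eq_mul] at this
    exact (mul_eq_zero.1 this).resolve_left hcz

variable {b : V →ₗ⋆[ℂ] V →ₗ[ℂ] ℂ} (hb : ∀ x y, b (f x) y = -b x (f y))

include hb

theorem apply_eq_zero_of_mem_maxGenEigenspace {z w : ℂ} (hzw : conj z + w ≠ 0) {x y : V}
    (hx : x ∈ f.maxGenEigenspace z) (hy : y ∈ f.maxGenEigenspace w) : b x y = 0 := by
  obtain ⟨k, hk⟩ := (Module.End.mem_maxGenEigenspace f z x).1 hx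
  clear hx
  induction k generalizing x y with
  | zero => rw [show x = 0 from hk, map_zero, LinearMap.zero_apply]
  | succ k ih =>
    refine apply_eq_zero_of_forall_apply_add_smul_eq_zero hzw (fun y hy => ?_) hy
    have hx' := ih hy (by rw [← Module.End.mul_apply, ← pow_succ, hk] :
      ((f - z • 1) ^ k) ((f - z • 1) x) = 0)
    simp only [LinearMap.sub_apply, LinearMap.smul_apply, Module.End.one_apply, map_sub, map_smulₛₗ,
      hb] at hx'
    rw [map_add, map_smul]
    linear_combination -hx'

theorem apply_eq_zero_of_mem_spectralSum (hst : ∀ z ∈ s, ∀ w ∈ t, conj z + w ≠ 0) {x y : V}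
    (hx : x ∈ spectralSum f s) (hy : y ∈ spectralSum f t) : b x y = 0 := by
  refine (spectralSum_le fun w hw y hy => ?_ : spectralSum f t ≤ LinearMap.ker (b x)) hy
  refine (spectralSum_le fun z hz x hx => ?_ : spectralSum f s ≤ LinearMap.ker (b.flip y)) hx
  exact apply_eq_zero_of_mem_maxGenEigenspace hb (hst z hz w hw) hx hy

end SpectralSum

section Complexification

variable {H : Type*} [AddCommGroup H] [Module ℝ H]

@[simp]
theorem conjC_tmul (z : ℂ) (x : H) : conjC H (z ⊗ₜ[ℝ] x) = conj z ⊗ₜ[ℝ] x := by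
  simp [conjC]

@[simp]
theorem conjC_conjC (x : ℂ ⊗[ℝ] H) : conjC H (conjC H x) = x := by
  suffices h : conjC H ∘ₗ conjC H = LinearMap.id from LinearMap.congr_fun h x
  ext z y
  simp

theorem conjC_smul (c : ℂ) (x : ℂ ⊗[ℝ] H) : conjC H (c • x) = conj c • conjC H x := by
  induction x with
  | zero => simp
  | tmul z x => simp [TensorProduct.smul_tmul']
  | add x y hx hy => rw [smul_add, map_add, map_add, smul_add, hx, hy]

theorem conjC_baseChange (A : End ℝ H) (x : ℂ ⊗[ℝ] H) :
    conjC H (A.baseChange ℂ x) = A.baseChange ℂ (conjC H x) := by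
  induction x with
  | zero => simp
  | tmul z x => simp
  | add x y hx hy => simp only [map_add, hx, hy]

/-- Complex conjugation on the complexification, as a semilinear map. -/
noncomputable def conjCₛₗ (H : Type*) [AddCommGroup H] [Module ℝ H] :
    ℂ ⊗[ℝ] H →ₗ⋆[ℂ] ℂ ⊗[ℝ] H where
  toFun := conjC H
  map_add' := map_add _
  map_smul' := conjC_smul

@[simp]
theorem conjCₛₗ_apply (x : ℂ ⊗[ℝ] H) : conjCₛₗ H x = conjC H x := rfl

/-- The sesquilinear extension `(x, y) ↦ B(x̄, y)` of a real bilinear form `B` to the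
complexification. -/
noncomputable def sesqExt (B : LinearMap.BilinForm ℝ H) : ℂ ⊗[ℝ] H →ₗ⋆[ℂ] ℂ ⊗[ℝ] H →ₗ[ℂ] ℂ :=
  LinearMap.comp (B.baseChange ℂ) (conjCₛₗ H)

@[simp]
theorem sesqExt_tmul_tmul (B : LinearMap.BilinForm ℝ H) (z w : ℂ) (x y : H) :
    sesqExt B (z ⊗ₜ[ℝ] x) (w ⊗ₜ[ℝ] y) = B x y * (conj z * w) := by
  simp [sesqExt, mul_comm]

theorem sesqExt_neg (B : LinearMap.BilinForm ℝ H) : sesqExt (-B) = -sesqExt B := by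
  have : (-B).baseChange ℂ = -B.baseChange ℂ := by
    ext x y
    simp
  rw [sesqExt, this]
  rfl

theorem sesqExt_compLeft (B : LinearMap.BilinForm ℝ H) (f : End ℝ H) (x y : ℂ ⊗[ℝ] H) :
    sesqExt (B.compLeft f) x y = sesqExt B (f.baseChange ℂ x) y := by
  have : (B.compLeft f).baseChange ℂ = (B.baseChange ℂ).compLeft (f.baseChange ℂ) := by
    ext x y
    simp
  simp [sesqExt, this, conjC_baseChange]

theorem conj_sesqExt (B : LinearMap.BilinForm ℝ H) (x y : ℂ ⊗[ℝ] H) :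
    conj (sesqExt B x y) = sesqExt B.flip y x := by
  induction x with
  | zero => simp
  | tmul z x =>
    induction y with
    | zero => simp
    | tmul w y => simp [mul_comm]
    | add y y' hy hy' => simp only [map_add, LinearMap.add_apply, hy, hy']
  | add x x' hx hx' => simp only [map_add, LinearMap.add_apply, hx, hx']

theorem sesqExt_conjC_conjC (B : LinearMap.BilinForm ℝ H) (x y : ℂ ⊗[ℝ] H) :
    sesqExt B (conjC H x) (conjC H y) = conj (sesqExt B x y) := by
  induction x with
  | zero => simp
  | tmul z x =>
    induction y with
    | zero => simp
    | tmul w y => simp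
    | add y y' hy hy' => simp only [map_add, hy, hy']
  | add x x' hx hx' => simp only [map_add, LinearMap.add_apply, hx, hx']

theorem isSymm_sesqExt {B : LinearMap.BilinForm ℝ H} (hB : B.IsSymm) : (sesqExt B).IsSymm :=
  ⟨fun x y => by
    rw [conj_sesqExt, show B.flip = B from LinearMap.ext₂ fun x y => hB.eq y x]⟩

theorem continuous_sesqExt {T : Type*} [TopologicalSpace T] {B : T → LinearMap.BilinForm ℝ H}
    (hB : ∀ x y, Continuous fun t => B t x y) (x y : ℂ ⊗[ℝ] H) :
    Continuous fun t => sesqExt (B t) x y := by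
  induction x with
  | zero => simpa using continuous_const
  | tmul z x =>
    induction y with
    | zero => simpa using continuous_const
    | tmul w y =>
      simp only [sesqExt_tmul_tmul]
      exact (Complex.continuous_ofReal.comp (hB x y)).mul continuous_const
    | add y y' hy hy' =>
      simp only [map_add]
      exact hy.add hy'
  | add x x' hx hx' =>
    simp only [map_add, LinearMap.add_apply]
    exact hx.add hx'

theorem exists_eq_one_tmul_add_I_tmul (P : Submodule ℝ H) {x : ℂ ⊗[ℝ] H}
    (hx : x ∈ P.baseChange ℂ) :
    ∃ a ∈ P, ∃ b ∈ P, x = 1 ⊗ₜ[ℝ] a + Complex.I ⊗ₜ[ℝ] b := by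
  obtain ⟨y, rfl⟩ := hx
  induction y with
  | zero => exact ⟨0, zero_mem _, 0, zero_mem _, by simp⟩
  | tmul z a =>
    refine ⟨z.re • (a : H), P.smul_mem _ a.2, z.im • (a : H), P.smul_mem _ a.2, ?_⟩
    rw [LinearMap.baseChange_tmul, ← TensorProduct.smul_tmul, ← TensorProduct.smul_tmul,
      ← TensorProduct.add_tmul]
    congr 1
    apply Complex.ext <;> simp
  | add x y hx hy =>
    obtain ⟨a, ha, b, hb, h⟩ := hx
    obtain ⟨a', ha', b', hb', h'⟩ := hy
    refine ⟨a + a', add_mem ha ha', b + b', add_mem hb hb', ?_⟩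
    rw [map_add, h, h', TensorProduct.tmul_add, TensorProduct.tmul_add, add_add_add_comm]

theorem finrank_submodule_baseChange (P : Submodule ℝ H) :
    finrank ℂ (P.baseChange ℂ) = finrank ℝ P := by
  have hinj : Function.Injective (P.subtype.baseChange ℂ) :=
    Module.Flat.lTensor_preserves_injective_linearMap (M := ℂ) P.subtype P.injective_subtype
  rw [Submodule.baseChange, LinearMap.finrank_range_of_inj hinj, finrank_baseChange]

theorem posDefOn_sesqExt {B : LinearMap.BilinForm ℝ H} {P : Submodule ℝ H}
    (hP : ∀ x ∈ P, x ≠ 0 → 0 < B x x) : PosDefOn (sesqExt B) (P.baseChange ℂ) := by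
  intro x hx hx0
  obtain ⟨a, ha, b, hb, rfl⟩ := exists_eq_one_tmul_add_I_tmul P hx
  have hre : (sesqExt B (1 ⊗ₜ[ℝ] a + Complex.I ⊗ₜ[ℝ] b) (1 ⊗ₜ[ℝ] a + Complex.I ⊗ₜ[ℝ] b)).re =
      B a a + B b b := by
    simp
  rw [hre]
  rcases eq_or_ne a 0 with rfl | ha0
  · simpa using hP b hb (by rintro rfl; simp at hx0)
  rcases eq_or_ne b 0 with rfl | hb0
  · simpa using hP a ha ha0
  exact add_pos (hP a ha ha0) (hP b hb hb0)

theorem nondegenerateOn_top_sesqExt {B : LinearMap.BilinForm ℝ H} (hB : B.SeparatingLeft) :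
    NondegenerateOn (sesqExt B) ⊤ := by
  intro x _ hx
  obtain ⟨a, -, b, -, rfl⟩ := exists_eq_one_tmul_add_I_tmul ⊤
    (by simp : x ∈ (⊤ : Submodule ℝ H).baseChange ℂ)
  have hab : ∀ y, B a y = 0 ∧ B b y = 0 := fun y => by
    simpa [Complex.ext_iff] using hx (1 ⊗ₜ[ℝ] y) Submodule.mem_top
  rw [hB a fun y => (hab y).1, hB b fun y => (hab y).2, TensorProduct.tmul_zero,
    TensorProduct.tmul_zero, add_zero]

theorem radical_toQuadraticMap_eq_bot {B : LinearMap.BilinForm ℝ H} (hs : B.IsSymm)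
    (hB : B.SeparatingLeft) : B.toQuadraticMap.radical = ⊥ := by
  rw [QuadraticMap.radical_eq_ker_associated, QuadraticMap.associated_left_inverse ℝ hs.eq]
  exact LinearMap.separatingLeft_iff_ker_eq_bot.1 hB

theorem hermitianSignature_sesqExt [FiniteDimensional ℝ H] {B : LinearMap.BilinForm ℝ H}
    (hs : B.IsSymm) (hB : B.SeparatingLeft) :
    hermitianSignature ⊤ (sesqExt B) =
      (sigPos B.toQuadraticMap : ℤ) - sigNeg B.toQuadraticMap := by
  obtain ⟨P, hPd, hP⟩ := exists_finrank_eq_sigPos_and_posDef B.toQuadraticMap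
  obtain ⟨N, hNd, hN⟩ := exists_finrank_eq_sigNeg_and_negDef B.toQuadraticMap
  have hsum := QuadraticForm.sigPos_add_sigNeg_add_radical (Q := B.toQuadraticMap)
  rw [radical_toQuadraticMap_eq_bot hs hB, finrank_bot, add_zero] at hsum
  have hsplit : IsDefiniteSplitting (sesqExt B) ⊤ (P.baseChange ℂ) (N.baseChange ℂ) := by
    refine ⟨le_top, le_top, posDefOn_sesqExt fun x hx h => ?_, ?_, ?_⟩
    · exact hP ⟨x, hx⟩ fun h' => h (congrArg Subtype.val h')
    · rw [← sesqExt_neg]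
      exact posDefOn_sesqExt fun x hx h => hN ⟨x, hx⟩ fun h' => h (congrArg Subtype.val h')
    · rw [finrank_submodule_baseChange, finrank_submodule_baseChange, finrank_top,
        finrank_baseChange, hPd, hNd, hsum]
  rw [hsplit.hermitianSignature_eq, finrank_submodule_baseChange, finrank_submodule_baseChange,
    hPd, hNd]

/-- The image of a complex subspace under complex conjugation. -/
noncomputable def conjSubmodule (P : Submodule ℂ (ℂ ⊗[ℝ] H)) : Submodule ℂ (ℂ ⊗[ℝ] H) :=
  P.comap (conjCₛₗ H)

@[simp]
theorem mem_conjSubmodule {P : Submodule ℂ (ℂ ⊗[ℝ] H)} {x : ℂ ⊗[ℝ] H} :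
    x ∈ conjSubmodule P ↔ conjC H x ∈ P := Iff.rfl

theorem finrank_conjSubmodule (P : Submodule ℂ (ℂ ⊗[ℝ] H)) :
    finrank ℂ (conjSubmodule P) = finrank ℂ P := by
  let j : conjSubmodule P ≃+ P :=
    { toFun := fun x => ⟨conjC H x, x.2⟩
      invFun := fun x => ⟨conjC H x, by simp⟩
      left_inv := fun x => by simp
      right_inv := fun x => by simp
      map_add' := fun x y => Subtype.ext (by simp) }
  unfold finrank
  rw [rank_eq_of_equiv_equiv (starRingEnd ℂ) j (star_involutive.bijective (α := ℂ))
    fun r m => Subtype.ext (conjC_smul r (m : ℂ ⊗[ℝ] H))]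

theorem PosDefOn.conjSubmodule {B : LinearMap.BilinForm ℝ H} {P : Submodule ℂ (ℂ ⊗[ℝ] H)}
    (hP : PosDefOn (sesqExt B) P) : PosDefOn (sesqExt B) (conjSubmodule P) := by
  intro x hx hx0
  have hx0' : conjC H x ≠ 0 := fun h => hx0 (by rw [← conjC_conjC x, h, map_zero])
  have := hP (conjC H x) hx hx0'
  rwa [sesqExt_conjC_conjC, Complex.conj_re] at this

theorem hermitianSignature_conjSubmodule [FiniteDimensional ℝ H] {B : LinearMap.BilinForm ℝ H}
    (hs : B.IsSymm) {E : Submodule ℂ (ℂ ⊗[ℝ] H)} (hE : NondegenerateOn (sesqExt B) E) :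
    hermitianSignature (conjSubmodule E) (sesqExt B) = hermitianSignature E (sesqExt B) := by
  obtain ⟨P, N, h⟩ := exists_isDefiniteSplitting (isSymm_sesqExt hs) hE
  have hconj : IsDefiniteSplitting (sesqExt B) (conjSubmodule E) (conjSubmodule P)
      (conjSubmodule N) :=
    { pos_le := Submodule.comap_mono h.pos_le
      neg_le := Submodule.comap_mono h.neg_le
      pos := h.pos.conjSubmodule
      neg := sesqExt_neg B ▸ (sesqExt_neg B ▸ h.neg : PosDefOn (sesqExt (-B)) N).conjSubmodule
      finrank_add_finrank := by simp only [finrank_conjSubmodule, h.finrank_add_finrank] }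
  simp only [h.hermitianSignature_eq, hconj.hermitianSignature_eq, finrank_conjSubmodule]

theorem conjSubmodule_maxGenEigenspace (A : End ℝ H) (z : ℂ) :
    conjSubmodule (End.maxGenEigenspace (A.baseChange ℂ) z) =
      End.maxGenEigenspace (A.baseChange ℂ) (conj z) := by
  have hsemiconj : Function.Semiconj (conjC H) (A.baseChange ℂ - conj z • 1 : End ℂ (ℂ ⊗[ℝ] H))
      (A.baseChange ℂ - z • 1 : End ℂ (ℂ ⊗[ℝ] H)) := fun x => by
    simp [conjC_baseChange, conjC_smul]
  have hinj : Function.Injective (conjC H) := Function.LeftInverse.injective conjC_conjC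
  ext x
  rw [mem_conjSubmodule, End.mem_maxGenEigenspace, End.mem_maxGenEigenspace]
  refine exists_congr fun k => ?_
  rw [Module.End.pow_apply, Module.End.pow_apply, ← (hsemiconj.iterate_right k).eq,
    map_eq_zero_iff _ hinj]

theorem conjSubmodule_spectralSum (A : End ℝ H) (s : Set ℂ) :
    conjSubmodule (spectralSum (A.baseChange ℂ) s) =
      spectralSum (A.baseChange ℂ) ((starRingEnd ℂ) ⁻¹' s) := by
  have hle : ∀ t : Set ℂ, spectralSum (A.baseChange ℂ) ((starRingEnd ℂ) ⁻¹' t) ≤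
      conjSubmodule (spectralSum (A.baseChange ℂ) t) := fun t => spectralSum_le fun z hz => by
    rw [← Complex.conj_conj z, ← conjSubmodule_maxGenEigenspace]
    exact Submodule.comap_mono (maxGenEigenspace_le_spectralSum _ hz)
  refine le_antisymm (fun x hx => ?_) (hle s)
  have hle' := hle ((starRingEnd ℂ) ⁻¹' s)
  simp only [Set.preimage_preimage, Complex.conj_conj, Set.preimage_id'] at hle'
  simpa using hle' (mem_conjSubmodule.1 hx)

end Complexification

section SkewSpectrum

variable {V : Type*} [AddCommGroup V] [Module ℂ V] {b : V →ₗ⋆[ℂ] V →ₗ[ℂ] ℂ} {f : End ℂ V}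

theorem isSymm_comp_I_smul (hb : b.IsSymm) (hf : ∀ x y, b (f x) y = -b x (f y)) :
    (b ∘ₛₗ (Complex.I • f)).IsSymm :=
  ⟨fun x y => by simp [← hb.eq y (f x), hf]⟩

theorem eq_zero_of_smul_add_smul_I_smul_eq_zero {t : ℝ} (ht : t ∈ Set.Icc 0 1) {x : V}
    (hx : x ∈ spectralSum f {z | z.re = 0 ∧ z.im < 0})
    (h : (1 - t : ℂ) • x + (t : ℂ) • Complex.I • f x = 0) : x = 0 := by
  by_contra hx0
  rcases eq_or_ne t 0 with rfl | ht0
  · simp [hx0] at h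
  have ht0' : (t : ℂ) ≠ 0 := Complex.ofReal_ne_zero.2 ht0
  have hfx : f x = (((1 - t) / t : ℝ) * Complex.I) • x := by
    have hscale : (-Complex.I / t) • ((1 - t : ℂ) • x + (t : ℂ) • Complex.I • f x) =
        f x - (((1 - t) / t : ℝ) * Complex.I) • x := by
      match_scalars <;> field_simp
      all_goals simp
    rw [h, smul_zero] at hscale
    exact sub_eq_zero.1 hscale.symm
  have him := (mem_of_eigenvector_mem_spectralSum hx hx0 hfx).2
  have : 0 ≤ (1 - t) / t := div_nonneg (sub_nonneg.2 ht.2) ht.1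
  rw [Complex.im_ofReal_mul, Complex.I_im, mul_one] at him
  linarith

variable [FiniteDimensional ℂ V]

theorem nondegenerateOn_spectralSum (hnd : NondegenerateOn b ⊤)
    (hf : ∀ x y, b (f x) y = -b x (f y)) {s : Set ℂ} (hs : ∀ z ∈ s, -conj z ∈ s) :
    NondegenerateOn b (spectralSum f s) := by
  rw [← spectralSum_sup_compl f s] at hnd
  have hst : ∀ z ∈ s, ∀ w ∈ sᶜ, conj z + w ≠ 0 := fun z hz w hw h =>
    hw (eq_neg_of_add_eq_zero_right h ▸ hs z hz)
  exact hnd.of_sup fun x hx y hy => apply_eq_zero_of_mem_spectralSum hf hst hx hy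

theorem hermitianSignature_spectralSum_union (hb : b.IsSymm) (hnd : NondegenerateOn b ⊤)
    (hf : ∀ x y, b (f x) y = -b x (f y)) {s t : Set ℂ} (hs : ∀ z ∈ s ∪ t, -conj z ∈ s ∪ t)
    (hst : ∀ z ∈ s, ∀ w ∈ t, conj z + w ≠ 0) (hdisj : Disjoint s t) :
    hermitianSignature (spectralSum f (s ∪ t)) b =
      hermitianSignature (spectralSum f s) b + hermitianSignature (spectralSum f t) b := by
  have hnd' := nondegenerateOn_spectralSum hnd hf hs
  rw [spectralSum_union] at hnd' ⊢
  exact hermitianSignature_sup hb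
    (fun x hx y hy => apply_eq_zero_of_mem_spectralSum hf hst hx hy)
    (disjoint_spectralSum f hdisj) hnd'

theorem hermitianSignature_spectralSum_re_ne_zero (hb : b.IsSymm) (hnd : NondegenerateOn b ⊤)
    (hf : ∀ x y, b (f x) y = -b x (f y)) :
    hermitianSignature (spectralSum f {z | z.re ≠ 0}) b = 0 := by
  have hnd' := nondegenerateOn_spectralSum hnd hf (s := {z | z.re ≠ 0}) (by simp)
  have hunion : {z : ℂ | z.re ≠ 0} = {z | 0 < z.re} ∪ {z | z.re < 0} := by
    ext z
    exact ne_iff_gt_or_lt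
  rw [hunion, spectralSum_union] at hnd' ⊢
  refine hermitianSignature_sup_eq_zero_of_isotropic hb
    (fun x hx => apply_eq_zero_of_mem_spectralSum hf (fun z hz w hw h => ?_) hx hx)
    (fun x hx => apply_eq_zero_of_mem_spectralSum hf (fun z hz w hw h => ?_) hx hx) hnd'
  all_goals
    have hre := congrArg Complex.re h
    rw [Complex.add_re, Complex.conj_re, Complex.zero_re] at hre
    rw [Set.mem_ofPred_eq] at hz hw
    linarith

theorem hermitianSignature_comp_I_smul (hb : b.IsSymm) (hnd : NondegenerateOn b ⊤)
    (hf : ∀ x y, b (f x) y = -b x (f y)) :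
    hermitianSignature (spectralSum f {z | z.re = 0 ∧ z.im < 0}) (b ∘ₛₗ (Complex.I • f)) =
      hermitianSignature (spectralSum f {z | z.re = 0 ∧ z.im < 0}) b := by
  set s := {z : ℂ | z.re = 0 ∧ z.im < 0}
  let g (t : unitInterval) : End ℂ V := (1 - t : ℂ) • 1 + (t : ℂ) • (Complex.I • f)
  have hg (t : unitInterval) (x y : V) :
      b (g t x) y = (1 - t : ℂ) * b x y + t * (b ∘ₛₗ (Complex.I • f)) x y := by
    simp [g, -Complex.coe_smul]
  have hsymm (t : unitInterval) : (b ∘ₛₗ g t).IsSymm :=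
    ⟨fun x y => by
      rw [LinearMap.comp_apply, LinearMap.comp_apply, hg, hg, map_add, map_mul, map_mul, hb.eq,
        (isSymm_comp_I_smul hb hf).eq]
      simp⟩
  have hcont (x y : V) : Continuous fun t => (b ∘ₛₗ g t) x y := by
    simp only [LinearMap.comp_apply, hg]
    fun_prop
  have hmaps (t : unitInterval) : ∀ x ∈ spectralSum f s, g t x ∈ spectralSum f s := fun x hx =>
    add_mem (Submodule.smul_mem _ _ hx) (Submodule.smul_mem _ _ (Submodule.smul_mem _ _
      (apply_mem_spectralSum hx)))
  have hs : ∀ z ∈ s, -conj z ∈ s := fun z hz => by simpa [s] using hz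
  have hlc := isLocallyConstant_hermitianSignature hsymm hcont fun t x hx h =>
    eq_zero_of_smul_add_smul_I_smul_eq_zero t.2 hx
      (nondegenerateOn_spectralSum hnd hf hs _ (hmaps t x hx) h)
  have hone : b ∘ₛₗ (1 : End ℂ V) = b := rfl
  simpa [g, hone] using
    hlc.apply_eq_of_isPreconnected isPreconnected_univ (Set.mem_univ 1) (Set.mem_univ 0)

theorem hermitianSignature_top_eq_add (hb : b.IsSymm) (hnd : NondegenerateOn b ⊤)
    (hf : ∀ x y, b (f x) y = -b x (f y)) (hinj : Function.Injective f) :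
    hermitianSignature ⊤ b = hermitianSignature (spectralSum f {z | z.re = 0 ∧ z.im < 0}) b +
      hermitianSignature (spectralSum f {z | z.re = 0 ∧ 0 < z.im}) b := by
  have h0 : ∀ z, f.HasEigenvalue z → z ≠ 0 := by
    rintro z hz rfl
    obtain ⟨x, hx⟩ := hz.exists_hasEigenvector
    exact hx.2 (hinj (by rw [hx.apply_eq_smul, zero_smul, map_zero]))
  have htop : spectralSum f ({z | z.re = 0 ∧ z.im < 0} ∪ {z | z.re = 0 ∧ 0 < z.im} ∪
      {z | z.re ≠ 0}) = ⊤ := by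
    refine spectralSum_eq_top fun z hz => ?_
    have := h0 z hz
    simp only [Ne, Complex.ext_iff, Complex.zero_re, Complex.zero_im] at this
    simp only [Set.mem_union, Set.mem_ofPred_eq]
    grind
  rw [← htop, hermitianSignature_spectralSum_union hb hnd hf,
    hermitianSignature_spectralSum_re_ne_zero hb hnd hf, add_zero,
    hermitianSignature_spectralSum_union hb hnd hf]
  all_goals
    simp only [Set.mem_union, Set.mem_ofPred_eq, Set.disjoint_left, Ne, Complex.ext_iff,
      Complex.neg_re, Complex.neg_im, Complex.add_re, Complex.add_im, Complex.conj_re,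
      Complex.conj_im, Complex.zero_re, Complex.zero_im]
    grind

end SkewSpectrum

section Cayley

variable {H : Type*} [AddCommGroup H] [Module ℝ H] {ω : LinearMap.BilinForm ℝ H} {X : End ℝ H}

/-- The infinitesimally symplectic endomorphisms, forming the Lie algebra `𝔰𝔭(ω)`. -/
def skewEnd (ω : LinearMap.BilinForm ℝ H) : Set (End ℝ H) :=
  {X | ∀ x y, ω (X x) y = -ω x (X y)}

/-- The injective infinitesimally symplectic endomorphisms. -/
def skewReg (ω : LinearMap.BilinForm ℝ H) : Set (End ℝ H) :=
  {X | X ∈ skewEnd ω ∧ Function.Injective X}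

/-- The domain of the Cayley transform: the injective infinitesimally symplectic endomorphisms
without the eigenvalue `1`. -/
def cayleyDomain (ω : LinearMap.BilinForm ℝ H) : Set (End ℝ H) :=
  {X | X ∈ skewReg ω ∧ Function.Injective (1 - X : End ℝ H)}

/-- The Cayley transform `-(1 + X)(1 - X)⁻¹`, with value `0` unless `1 - X` is invertible. The sign
makes it an involution. -/
noncomputable def cayley (X : End ℝ H) : End ℝ H :=
  -(1 + X) * Ring.inverse (1 - X)

/-- The quadratic form `ω(X x, x)`. -/
noncomputable def skewQuad (ω : LinearMap.BilinForm ℝ H) (X : End ℝ H) : QuadraticForm ℝ H :=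
  (ω.compLeft X).toQuadraticMap

@[simp]
theorem skewQuad_apply (x : H) : skewQuad ω X x = ω (X x) x := rfl

theorem isSymm_compLeft (hAlt : ω.IsAlt) (hX : X ∈ skewEnd ω) : (ω.compLeft X).IsSymm :=
  ⟨fun x y => by
    rw [LinearMap.BilinForm.compLeft_apply, LinearMap.BilinForm.compLeft_apply,
      hX x y, hAlt.neg_eq]⟩

theorem separatingLeft_compLeft (hω : ω.SeparatingLeft) (hX : Function.Injective X) :
    (ω.compLeft X).SeparatingLeft := fun x hx =>
  hX ((hω (X x) hx).trans (map_zero X).symm)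

variable [FiniteDimensional ℝ H]

theorem isUnit_iff_injective : IsUnit X ↔ Function.Injective X := by
  rw [LinearMap.isUnit_iff_ker_eq_bot, LinearMap.ker_eq_bot]

theorem injective_iff_det_ne_zero : Function.Injective X ↔ LinearMap.det X ≠ 0 := by
  rw [← isUnit_iff_injective, LinearMap.isUnit_iff_isUnit_det, isUnit_iff_ne_zero]

theorem notMem_spectrum_iff {r : ℝ} :
    r ∉ spectrum ℝ X ↔ Function.Injective (r • 1 - X : End ℝ H) := by
  rw [spectrum.notMem_iff, isUnit_iff_injective, Algebra.algebraMap_eq_smul_one]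

theorem cayley_mul_one_sub (hX : Function.Injective (1 - X : End ℝ H)) :
    cayley X * (1 - X) = -(1 + X) := by
  rw [cayley, mul_assoc, Ring.inverse_mul_cancel _ (isUnit_iff_injective.2 hX), mul_one]

theorem commute_one_sub_cayley (hX : Function.Injective (1 - X : End ℝ H)) :
    Commute (1 - X) (cayley X) := by
  have hu := isUnit_iff_injective.2 hX
  have hcomm : Commute (1 - X) (-(1 + X)) := by
    rw [Commute, SemiconjBy]
    noncomm_ring
  exact hcomm.mul_right
    ((Ring.mul_inverse_cancel _ hu).trans (Ring.inverse_mul_cancel _ hu).symm)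

theorem cayley_sub_apply (hX : Function.Injective (1 - X : End ℝ H)) (u : H) :
    cayley X (u - X u) = -(u + X u) :=
  LinearMap.congr_fun (cayley_mul_one_sub hX) u

theorem exists_sub_apply_eq (hX : Function.Injective (1 - X : End ℝ H)) (x : H) :
    ∃ u, u - X u = x :=
  LinearMap.injective_iff_surjective.1 hX x

theorem one_sub_cayley_mul_one_sub (hX : Function.Injective (1 - X : End ℝ H)) :
    (1 - cayley X) * (1 - X) = (2 : ℝ) • 1 := by
  rw [sub_mul, cayley_mul_one_sub hX, one_mul]
  module

theorem injective_one_sub_cayley (hX : Function.Injective (1 - X : End ℝ H)) :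
    Function.Injective (1 - cayley X : End ℝ H) := by
  have h : Function.Surjective ((1 - cayley X : End ℝ H) ∘ (1 - X : End ℝ H)) := fun x =>
    ⟨(2 : ℝ)⁻¹ • x, (LinearMap.congr_fun (one_sub_cayley_mul_one_sub hX) _).trans (by simp)⟩
  exact LinearMap.injective_iff_surjective.2 h.of_comp

theorem cayley_cayley (hX : Function.Injective (1 - X : End ℝ H)) : cayley (cayley X) = X := by
  ext x
  have h := cayley_sub_apply (injective_one_sub_cayley hX) ((2 : ℝ)⁻¹ • (x - X x))
  rw [map_smul, cayley_sub_apply hX,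
    show (2 : ℝ)⁻¹ • (x - X x) - (2 : ℝ)⁻¹ • -(x + X x) = x by module] at h
  rw [h]
  module

theorem sign_det_one_sub_cayley (hX : Function.Injective (1 - X : End ℝ H)) :
    SignType.sign (LinearMap.det (1 - cayley X)) = SignType.sign (LinearMap.det (1 - X)) := by
  have h := congrArg LinearMap.det (one_sub_cayley_mul_one_sub hX)
  rw [map_mul, LinearMap.det_smul, map_one, mul_one] at h
  have hpos : 0 < LinearMap.det (1 - cayley X) * LinearMap.det (1 - X) := by rw [h]; positivity
  rcases pos_and_pos_or_neg_and_neg_of_mul_pos hpos with ⟨h1, h2⟩ | ⟨h1, h2⟩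
  · rw [sign_pos h1, sign_pos h2]
  · rw [sign_neg h1, sign_neg h2]

theorem cayley_mem_Sp (hX : X ∈ cayleyDomain ω) : cayley X ∈ Sp ω := by
  obtain ⟨⟨hs, -⟩, h1⟩ := hX
  intro x y
  obtain ⟨u, rfl⟩ := exists_sub_apply_eq h1 x
  obtain ⟨v, rfl⟩ := exists_sub_apply_eq h1 y
  simp only [cayley_sub_apply h1, map_neg, map_add, map_sub, LinearMap.neg_apply,
    LinearMap.add_apply, LinearMap.sub_apply, hs u v]
  ring

theorem one_notMem_spectrum_cayley (hX : X ∈ cayleyDomain ω) : (1 : ℝ) ∉ spectrum ℝ (cayley X) := by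
  rw [notMem_spectrum_iff, one_smul]
  exact injective_one_sub_cayley hX.2

theorem neg_one_notMem_spectrum_cayley (hX : X ∈ cayleyDomain ω) :
    (-1 : ℝ) ∉ spectrum ℝ (cayley X) := by
  rw [notMem_spectrum_iff, ← LinearMap.ker_eq_bot, LinearMap.ker_eq_bot']
  intro x hx
  obtain ⟨u, rfl⟩ := exists_sub_apply_eq hX.2 x
  simp only [LinearMap.sub_apply, LinearMap.smul_apply, Module.End.one_apply,
    cayley_sub_apply hX.2] at hx
  have h2 : X ((2 : ℝ) • u) = X 0 := by
    rw [map_smul, map_zero, ← hx]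
    module
  rw [(smul_eq_zero_iff_right two_ne_zero).1 (hX.1.2 h2), map_zero, sub_zero]

theorem cayley_mem_cayleyDomain (A : SpStarStar ω) : cayley A.1 ∈ cayleyDomain ω := by
  obtain ⟨A, hA, h1, h1'⟩ := A
  rw [notMem_spectrum_iff, one_smul] at h1
  rw [notMem_spectrum_iff] at h1'
  refine ⟨⟨fun x y => ?_, ?_⟩, injective_one_sub_cayley h1⟩
  · obtain ⟨u, rfl⟩ := exists_sub_apply_eq h1 x
    obtain ⟨v, rfl⟩ := exists_sub_apply_eq h1 y
    simp only [cayley_sub_apply h1, map_neg, map_add, map_sub, LinearMap.neg_apply,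
      LinearMap.add_apply, LinearMap.sub_apply, hA u v]
    ring
  · rw [← LinearMap.ker_eq_bot, LinearMap.ker_eq_bot']
    intro x hx
    obtain ⟨u, rfl⟩ := exists_sub_apply_eq h1 x
    rw [cayley_sub_apply h1] at hx
    have h2 : ((-1 : ℝ) • 1 - A) u = ((-1 : ℝ) • 1 - A) 0 := by
      rw [map_zero, ← hx]
      simp only [LinearMap.sub_apply, LinearMap.smul_apply, Module.End.one_apply]
      module
    rw [h1' h2, map_zero, sub_zero]

end Cayley

section KreinIndex

variable {H : Type*} [AddCommGroup H] [Module ℝ H] {ω : LinearMap.BilinForm ℝ H} {X : End ℝ H}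

theorem re_add_one_div_sub_one (z : ℂ) :
    ((z + 1) / (z - 1)).re = (Complex.normSq z - 1) / Complex.normSq (z - 1) := by
  simp only [Complex.div_re, Complex.normSq_apply, Complex.add_re, Complex.add_im, Complex.sub_re,
    Complex.sub_im, Complex.one_re, Complex.one_im]
  ring

theorem im_add_one_div_sub_one (z : ℂ) :
    ((z + 1) / (z - 1)).im = -(2 * z.im) / Complex.normSq (z - 1) := by
  simp only [Complex.div_im, Complex.normSq_apply, Complex.add_re, Complex.add_im, Complex.sub_re,
    Complex.sub_im, Complex.one_re, Complex.one_im]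
  ring

theorem isSymm_I_smul_sesqExt (hAlt : ω.IsAlt) : (Complex.I • sesqExt ω).IsSymm := by
  have hflip : ω.flip = -ω := LinearMap.ext₂ fun x y => (hAlt.neg_eq x y).symm
  refine ⟨fun x y => ?_⟩
  simp [conj_sesqExt, hflip, sesqExt_neg]

theorem sesqExt_compLeft_eq (ω : LinearMap.BilinForm ℝ H) (X : End ℝ H) :
    sesqExt (ω.compLeft X) = (Complex.I • sesqExt ω) ∘ₛₗ (Complex.I • X.baseChange ℂ) := by
  ext x y
  simp [sesqExt_compLeft, ← mul_assoc]

theorem sesqExt_baseChange_apply (hX : X ∈ skewEnd ω) (x y : ℂ ⊗[ℝ] H) :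
    sesqExt ω (X.baseChange ℂ x) y = -sesqExt ω x (X.baseChange ℂ y) := by
  have hskew : (ω.baseChange ℂ).compLeft (X.baseChange ℂ) =
      -(ω.baseChange ℂ).compRight (X.baseChange ℂ) := by
    ext x y
    simp [hX x y]
  simpa [sesqExt, conjC_baseChange] using LinearMap.congr_fun₂ hskew (conjC H x) y

variable [FiniteDimensional ℝ H]

theorem maxGenEigenspace_baseChange_cayley (hX : Function.Injective (1 - X : End ℝ H)) {z : ℂ}
    (hz : z ≠ 1) : End.maxGenEigenspace ((cayley X).baseChange ℂ) z =
      End.maxGenEigenspace (X.baseChange ℂ) ((z + 1) / (z - 1)) := by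
  have hcomm := commute_one_sub_cayley hX
  refine maxGenEigenspace_eq_of_mul_sub_eq_smul_sub (u := (1 - X).baseChange ℂ) (c := z - 1)
    (Module.Flat.lTensor_preserves_injective_linearMap (M := ℂ) _ hX) ?_ (sub_ne_zero.2 hz) ?_
  · exact hcomm.map (Module.End.baseChangeHom ℝ ℂ H)
  · have hmul : (1 - X).baseChange ℂ * (cayley X).baseChange ℂ = -(1 + X.baseChange ℂ) := by
      rw [← LinearMap.baseChange_mul, hcomm.eq, cayley_mul_one_sub hX]
      simp
    have hsub : (1 - X).baseChange ℂ = 1 - X.baseChange ℂ := by simp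
    rw [mul_sub, hmul, hsub, smul_sub, smul_smul, mul_div_cancel₀ _ (sub_ne_zero.2 hz)]
    simp only [mul_smul_comm, mul_one]
    module

theorem kreinSpace_cayley (hX : Function.Injective (1 - X : End ℝ H)) :
    kreinSpace (cayley X) = spectralSum (X.baseChange ℂ) {z | z.re = 0 ∧ z.im < 0} := by
  refine le_antisymm (spectralSum_le fun z hz => ?_) (spectralSum_le fun w hw => ?_)
  · have hz1 : z ≠ 1 := by rintro rfl; simp at hz
    rw [maxGenEigenspace_baseChange_cayley hX hz1]
    refine maxGenEigenspace_le_spectralSum _ ⟨?_, ?_⟩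
    · rw [re_add_one_div_sub_one, Complex.normSq_eq_norm_sq, hz.1, sub_self, zero_div]
    · rw [im_add_one_div_sub_one]
      exact div_neg_of_neg_of_pos (by linarith [hz.2]) (Complex.normSq_pos.2 (sub_ne_zero.2 hz1))
  · have hw1 : w ≠ 1 := by rintro rfl; simp at hw
    have h := maxGenEigenspace_baseChange_cayley (injective_one_sub_cayley hX) hw1
    rw [cayley_cayley hX] at h
    rw [h]
    refine maxGenEigenspace_le_spectralSum ((cayley X).baseChange ℂ) ⟨?_, ?_⟩
    · have hsq : Complex.normSq (w + 1) = Complex.normSq (w - 1) := by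
        simp [Complex.normSq_apply, hw.1]
      rw [← Complex.normSq_eq_norm_sq, Complex.normSq_div, hsq]
      exact div_self (Complex.normSq_pos.2 (sub_ne_zero.2 hw1)).ne'
    · rw [im_add_one_div_sub_one]
      exact div_pos (by linarith [hw.2]) (Complex.normSq_pos.2 (sub_ne_zero.2 hw1))

theorem two_mul_kreinIndex_cayley_eq_hermitianSignature (hAlt : ω.IsAlt) (hNondeg : ω.Nondegenerate)
    (hX : X ∈ cayleyDomain ω) :
    2 * kreinIndex ω (cayley X) = hermitianSignature ⊤ (sesqExt (ω.compLeft X)) := by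
  obtain ⟨⟨hskew, hinj⟩, h1⟩ := hX
  have hb := isSymm_I_smul_sesqExt hAlt
  have hsymm := isSymm_compLeft hAlt hskew
  have hf : ∀ x y, (Complex.I • sesqExt ω) (X.baseChange ℂ x) y =
      -(Complex.I • sesqExt ω) x (X.baseChange ℂ y) := fun x y => by
    simp [sesqExt_baseChange_apply hskew]
  have hndω : NondegenerateOn (Complex.I • sesqExt ω) ⊤ := fun x hx h =>
    nondegenerateOn_top_sesqExt hNondeg.1 x hx fun y hy => by simpa using h y hy
  have hnd : NondegenerateOn (sesqExt (ω.compLeft X)) ⊤ :=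
    nondegenerateOn_top_sesqExt (separatingLeft_compLeft hNondeg.1 hinj)
  have hf' : ∀ x y, sesqExt (ω.compLeft X) (X.baseChange ℂ x) y =
      -sesqExt (ω.compLeft X) x (X.baseChange ℂ y) := fun x y => by
    rw [sesqExt_compLeft, sesqExt_compLeft, sesqExt_baseChange_apply hskew]
  set E := spectralSum (X.baseChange ℂ) {z | z.re = 0 ∧ z.im < 0} with hE
  have hκ : kreinIndex ω (cayley X) = hermitianSignature E (sesqExt (ω.compLeft X)) := by
    rw [sesqExt_compLeft_eq, hermitianSignature_comp_I_smul hb hndω hf, ← kreinSpace_cayley h1]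
    rfl
  have hconj : spectralSum (X.baseChange ℂ) {z | z.re = 0 ∧ 0 < z.im} = conjSubmodule E := by
    rw [hE, conjSubmodule_spectralSum]
    simp
  rw [hermitianSignature_top_eq_add (isSymm_sesqExt hsymm) hnd hf'
    (Module.Flat.lTensor_preserves_injective_linearMap (M := ℂ) X hinj), hconj,
    hermitianSignature_conjSubmodule hsymm (nondegenerateOn_spectralSum hnd hf' (by simp)), hκ,
    two_mul]

theorem two_mul_kreinIndex_cayley (hAlt : ω.IsAlt) (hNondeg : ω.Nondegenerate)
    (hX : X ∈ cayleyDomain ω) :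
    2 * kreinIndex ω (cayley X) = (sigPos (skewQuad ω X) : ℤ) - sigNeg (skewQuad ω X) := by
  rw [two_mul_kreinIndex_cayley_eq_hermitianSignature hAlt hNondeg hX]
  exact hermitianSignature_sesqExt (isSymm_compLeft hAlt hX.1.1)
    (separatingLeft_compLeft hNondeg.1 hX.1.2)

theorem sigPos_add_sigNeg_skewQuad (hAlt : ω.IsAlt) (hNondeg : ω.Nondegenerate)
    (hX : X ∈ skewReg ω) :
    sigPos (skewQuad ω X) + sigNeg (skewQuad ω X) = finrank ℝ H := by
  have := QuadraticForm.sigPos_add_sigNeg_add_radical (Q := skewQuad ω X)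
  rwa [skewQuad, radical_toQuadraticMap_eq_bot (isSymm_compLeft hAlt hX.1)
    (separatingLeft_compLeft hNondeg.1 hX.2), finrank_bot, add_zero] at this

end KreinIndex

section EndTopology

variable {H : Type*} [AddCommGroup H] [Module ℝ H]

/-- The module topology on the endomorphisms of a real vector space. -/
abbrev endTopology (H : Type*) [AddCommGroup H] [Module ℝ H] : TopologicalSpace (End ℝ H) :=
  moduleTopology ℝ (End ℝ H)

attribute [local instance] endTopology

theorem isModuleTopology_end (H : Type*) [AddCommGroup H] [Module ℝ H] :
    IsModuleTopology ℝ (End ℝ H) := ⟨rfl⟩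

attribute [local instance] isModuleTopology_end

theorem isTopologicalRing_end (H : Type*) [AddCommGroup H] [Module ℝ H] [FiniteDimensional ℝ H] :
    IsTopologicalRing (End ℝ H) := IsModuleTopology.isTopologicalRing ℝ _

attribute [local instance] isTopologicalRing_end

variable {ι : Type*} [Fintype ι] [DecidableEq ι]

theorem continuous_toMatrix (v : Basis ι ℝ H) :
    Continuous (LinearMap.toMatrix v v : End ℝ H → Matrix ι ι ℝ) :=
  IsModuleTopology.continuous_of_linearMap (LinearMap.toMatrix v v).toLinearMap

variable [FiniteDimensional ℝ H]

theorem continuous_toLin (v : Basis ι ℝ H) :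
    Continuous (Matrix.toLin v v : Matrix ι ι ℝ → End ℝ H) := by
  have : IsModuleTopology ℝ (Matrix ι ι ℝ) := inferInstanceAs (IsModuleTopology ℝ (ι → ι → ℝ))
  exact IsModuleTopology.continuous_of_linearMap (Matrix.toLin v v).toLinearMap

theorem continuous_det_end : Continuous (LinearMap.det : End ℝ H → ℝ) := by
  rw [show (LinearMap.det : End ℝ H → ℝ) = fun f => (LinearMap.toMatrix _ _ f).det from
    funext fun f => (LinearMap.det_toMatrix (finBasis ℝ H) f).symm]
  exact (continuous_toMatrix _).matrix_det

theorem continuousOn_ringInverse_end :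
    ContinuousOn (Ring.inverse : End ℝ H → End ℝ H) {f | IsUnit f} := by
  let v := finBasis ℝ H
  have heq : ∀ f ∈ {f : End ℝ H | IsUnit f},
      Ring.inverse f = Matrix.toLin v v (LinearMap.toMatrix v v f)⁻¹ := by
    rintro _ ⟨u, rfl⟩
    rw [Ring.inverse_unit, ← LinearMap.toMatrix_symm, LinearEquiv.eq_symm_apply]
    exact Matrix.coe_units_inv (Units.map (LinearMap.toMatrixAlgEquiv v).toMonoidHom u)
  refine ContinuousOn.congr (fun f hf => ?_) heq
  have hdet : (LinearMap.toMatrix v v f).det ≠ 0 := by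
    rw [LinearMap.det_toMatrix]
    exact ((LinearMap.isUnit_iff_isUnit_det f).1 hf).ne_zero
  have hinv : ContinuousAt (Ring.inverse : ℝ → ℝ) (LinearMap.toMatrix v v f).det := by
    rw [Ring.inverse_eq_inv']
    exact continuousAt_inv₀ hdet
  exact ((continuous_toLin v).continuousAt.comp ((continuousAt_matrix_inv _ hinv).comp
    (continuous_toMatrix v).continuousAt)).continuousWithinAt

theorem continuousOn_cayley :
    ContinuousOn (cayley : End ℝ H → End ℝ H) {X | Function.Injective (1 - X : End ℝ H)} := by
  unfold cayley
  exact ContinuousOn.mul (by fun_prop) (continuousOn_ringInverse_end.comp (by fun_prop)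
    fun X hX => isUnit_iff_injective.2 hX)

end EndTopology

section MatrixPaths

variable {ι : Type*} [Fintype ι] [DecidableEq ι]

theorem joinedIn_det_ne_zero_mul {A B C D : Matrix ι ι ℝ}
    (h : JoinedIn {M : Matrix ι ι ℝ | M.det ≠ 0} A B)
    (h' : JoinedIn {M : Matrix ι ι ℝ | M.det ≠ 0} C D) :
    JoinedIn {M : Matrix ι ι ℝ | M.det ≠ 0} (A * C) (B * D) := by
  refine (h.mul h').mono ?_
  rintro _ ⟨M, hM, N, hN, rfl⟩
  exact (Matrix.det_mul M N).trans_ne (mul_ne_zero hM hN)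

theorem joinedIn_prod_transvections_one (L : List (Matrix.TransvectionStruct ι ℝ)) :
    JoinedIn {M : Matrix ι ι ℝ | M.det ≠ 0}
      (L.map Matrix.TransvectionStruct.toMatrix).prod 1 := by
  induction L with
  | nil => exact JoinedIn.refl (by simp)
  | cons t L ih =>
    rw [List.map_cons, List.prod_cons, ← mul_one (1 : Matrix ι ι ℝ)]
    refine joinedIn_det_ne_zero_mul (JoinedIn.symm ?_) ih
    refine JoinedIn.ofLine (f := fun s => Matrix.transvection t.i t.j (s * t.c)) ?_ ?_ ?_ ?_
    · refine (continuous_matrix fun a b => ?_).continuousOn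
      simp only [Matrix.transvection, Matrix.add_apply, Matrix.single_apply]
      split_ifs <;> fun_prop
    · simp
    · simp [Matrix.TransvectionStruct.toMatrix]
    · rintro _ ⟨s, -, rfl⟩
      simp [Matrix.det_transvection_of_ne _ _ t.hij]

theorem joinedIn_diagonal_sign {D : ι → ℝ} (hD : ∀ i, D i ≠ 0) :
    JoinedIn {M : Matrix ι ι ℝ | M.det ≠ 0} (Matrix.diagonal D)
      (Matrix.diagonal fun i => (SignType.sign (D i) : ℝ)) := by
  refine JoinedIn.ofLine (f := fun s : ℝ => Matrix.diagonal fun i =>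
    (SignType.sign (D i) : ℝ) * ((1 - s) * |D i| + s)) ?_ ?_ ?_ ?_
  · exact Continuous.continuousOn (by fun_prop)
  · simp only [sub_zero, one_mul, add_zero, sign_mul_abs]
  · simp only [sub_self, zero_mul, zero_add, mul_one]
  · rintro _ ⟨s, ⟨hs0, hs1⟩, rfl⟩
    rw [Set.mem_ofPred_eq, Matrix.det_diagonal]
    refine Finset.prod_ne_zero_iff.2 fun i _ => mul_ne_zero ?_ (ne_of_gt ?_)
    · rcases (hD i).lt_or_gt with h | h <;> simp [h]
    · nlinarith [mul_nonneg (sub_nonneg.2 hs1) (abs_nonneg (D i)), abs_pos.2 (hD i)]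

theorem exists_joinedIn_diagonal_sign {M : Matrix ι ι ℝ} (hM : M.det ≠ 0) :
    ∃ ε : ι → ℝ, (∀ i, ε i * ε i = 1) ∧
      JoinedIn {M : Matrix ι ι ℝ | M.det ≠ 0} M (Matrix.diagonal ε) := by
  obtain ⟨L, L', D, rfl⟩ := Matrix.Pivot.exists_list_transvec_mul_diagonal_mul_list_transvec M
  have hD : ∀ i, D i ≠ 0 := by
    have hdet : (Matrix.diagonal D).det ≠ 0 := fun h => hM (by simp [Matrix.det_mul, h])
    rw [Matrix.det_diagonal] at hdet
    exact fun i => Finset.prod_ne_zero_iff.1 hdet i (Finset.mem_univ i)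
  refine ⟨fun i => SignType.sign (D i), fun i => ?_, ?_⟩
  · rcases (hD i).lt_or_gt with h | h <;> simp [h]
  · simpa only [one_mul, mul_one] using joinedIn_det_ne_zero_mul (joinedIn_det_ne_zero_mul
      (joinedIn_prod_transvections_one L) (joinedIn_diagonal_sign hD))
      (joinedIn_prod_transvections_one L')

end MatrixPaths

section Sylvester

open QuadraticMap

theorem equivalent_weightedSumSquares_comp {ι ι' : Type*} [Fintype ι] [Fintype ι'] (σ : ι ≃ ι')
    (w : ι' → ℝ) : Equivalent (weightedSumSquares ℝ (w ∘ σ)) (weightedSumSquares ℝ w) := by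
  refine ⟨⟨LinearEquiv.funCongrLeft ℝ ℝ σ.symm, fun x => ?_⟩⟩
  simp only [weightedSumSquares_apply]
  exact (Fintype.sum_equiv σ _ _ fun i => by simp [LinearEquiv.funCongrLeft]).symm

theorem exists_comp_equiv_eq_of_signs {ι : Type*} [Finite ι] {w w' : ι → ℝ}
    (hw : ∀ i, w i = -1 ∨ w i = 1) (hw' : ∀ i, w' i = -1 ∨ w' i = 1)
    (h : Nat.card {i // 0 < w i} = Nat.card {i // 0 < w' i}) : ∃ σ : ι ≃ ι, w' ∘ σ = w := by
  classical
  have := Fintype.ofFinite ι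
  obtain ⟨τ⟩ : Nonempty ({i // 0 < w i} ≃ {i // 0 < w' i}) := Finite.card_eq.1 h
  have hpos : ∀ i, 0 < w' (τ.extendSubtype i) ↔ 0 < w i := fun i =>
    ⟨fun hi => by_contra fun hi' => τ.extendSubtype_not_mem i hi' hi, τ.extendSubtype_mem i⟩
  refine ⟨τ.extendSubtype, funext fun i => ?_⟩
  have := hpos i
  rw [Function.comp_apply]
  rcases hw i with h1 | h1 <;> rcases hw' (τ.extendSubtype i) with h2 | h2 <;> grind

theorem equivalent_of_sigPos_eq {H : Type*} [AddCommGroup H] [Module ℝ H] [FiniteDimensional ℝ H]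
    {Q Q' : QuadraticForm ℝ H} (hQ : (associated (R := ℝ) Q).SeparatingLeft)
    (hQ' : (associated (R := ℝ) Q').SeparatingLeft) (h : sigPos Q = sigPos Q') :
    Equivalent Q Q' := by
  obtain ⟨w, hw, e⟩ := Q.equivalent_one_neg_one_weighted_sum_squared hQ
  obtain ⟨w', hw', e'⟩ := Q'.equivalent_one_neg_one_weighted_sum_squared hQ'
  rw [QuadraticForm.sigPos_of_equiv_weightedSumSquares e,
    QuadraticForm.sigPos_of_equiv_weightedSumSquares e'] at h
  obtain ⟨σ, rfl⟩ := exists_comp_equiv_eq_of_signs hw hw' h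
  exact (e.trans (equivalent_weightedSumSquares_comp σ w')).trans e'.symm

end Sylvester

section SkewPaths

theorem compl₁₂_toLin_diagonal {R M ι : Type*} [CommRing R] [AddCommGroup M] [Module R M]
    [Fintype ι] [DecidableEq ι] {v : Basis ι R M} {B : LinearMap.BilinForm R M}
    (hv : B.IsOrthoᵢ v) {ε : ι → R} (hε : ∀ i, ε i * ε i = 1) :
    B.compl₁₂ (Matrix.toLin v v (Matrix.diagonal ε)) (Matrix.toLin v v (Matrix.diagonal ε)) =
      B := by
  have hdiag : ∀ i, Matrix.toLin v v (Matrix.diagonal ε) (v i) = ε i • v i := fun i => by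
    simp [Matrix.toLin_self, Matrix.diagonal_apply]
  refine v.ext fun i => v.ext fun j => ?_
  rw [LinearMap.compl₁₂_apply, hdiag, hdiag, map_smul, map_smul, LinearMap.smul_apply,
    smul_smul, smul_eq_mul]
  rcases eq_or_ne j i with rfl | hij
  · rw [hε, one_mul]
  · rw [hv hij.symm, mul_zero]

variable {H : Type*} [AddCommGroup H] [Module ℝ H] {ω : LinearMap.BilinForm ℝ H} {X Y : End ℝ H}

theorem compLeft_injective (hω : ω.SeparatingLeft) :
    Function.Injective (ω.compLeft : End ℝ H → LinearMap.BilinForm ℝ H) := fun Y Z h => by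
  ext x
  refine sub_eq_zero.1 (hω _ fun y => ?_)
  rw [map_sub, LinearMap.sub_apply, sub_eq_zero]
  exact LinearMap.congr_fun₂ h x y

theorem associated_skewQuad (hAlt : ω.IsAlt) (hX : X ∈ skewEnd ω) :
    QuadraticMap.associated (R := ℝ) (skewQuad ω X) = ω.compLeft X :=
  QuadraticMap.associated_left_inverse ℝ (isSymm_compLeft hAlt hX).eq

variable [FiniteDimensional ℝ H]

attribute [local instance] endTopology isModuleTopology_end isTopologicalRing_end

theorem exists_joinedIn_injective_diagonal_sign {ι : Type*} [Fintype ι] [DecidableEq ι]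
    (v : Basis ι ℝ H) {g : End ℝ H} (hg : Function.Injective g) :
    ∃ ε : ι → ℝ, (∀ i, ε i * ε i = 1) ∧
      JoinedIn {g : End ℝ H | Function.Injective g} g (Matrix.toLin v v (Matrix.diagonal ε)) := by
  have hdet : (LinearMap.toMatrix v v g).det ≠ 0 := by
    rwa [LinearMap.det_toMatrix, ← injective_iff_det_ne_zero]
  obtain ⟨ε, hε, h⟩ := exists_joinedIn_diagonal_sign hdet
  refine ⟨ε, hε, ?_⟩
  have hmap := h.map (continuous_toLin v)
  rw [Matrix.toLin_toMatrix] at hmap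
  refine hmap.mono ?_
  rintro _ ⟨M, hM, rfl⟩
  rwa [Set.mem_ofPred_eq, injective_iff_det_ne_zero, LinearMap.det_toLin]

/-- The adjoint with respect to a nondegenerate form, as a linear map. -/
noncomputable def formAdjoint (ω : LinearMap.BilinForm ℝ H) (hω : ω.Nondegenerate) :
    End ℝ H →ₗ[ℝ] End ℝ H :=
  (ω.toDual hω).symm.conj.toLinearMap ∘ₗ Module.Dual.transpose

theorem formAdjoint_apply (hω : ω.Nondegenerate) (g : End ℝ H) (x y : H) :
    ω (formAdjoint ω hω g x) y = ω x (g y) := by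
  rw [← LinearMap.BilinForm.toDual_def hω]
  simp only [formAdjoint, LinearMap.comp_apply, LinearEquiv.coe_coe, LinearEquiv.conj_apply,
    LinearEquiv.symm_symm, LinearEquiv.apply_symm_apply]
  exact LinearMap.BilinForm.toDual_def hω

theorem compLeft_formAdjoint_mul_mul (hω : ω.Nondegenerate) (X k : End ℝ H) :
    ω.compLeft (formAdjoint ω hω k * X * k) = (ω.compLeft X).compl₁₂ k k :=
  LinearMap.ext₂ fun x y => formAdjoint_apply hω k (X (k x)) y

theorem formAdjoint_mul_mul_mem_skewReg (hAlt : ω.IsAlt) (hω : ω.Nondegenerate)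
    (hX : X ∈ skewReg ω) {k : End ℝ H} (hk : Function.Injective k) :
    formAdjoint ω hω k * X * k ∈ skewReg ω := by
  have hform : ∀ x y, ω ((formAdjoint ω hω k * X * k) x) y = ω (X (k x)) (k y) :=
    LinearMap.congr_fun₂ (compLeft_formAdjoint_mul_mul hω X k)
  refine ⟨fun x y => ?_, LinearMap.ker_eq_bot.1 (LinearMap.ker_eq_bot'.2 fun x hx => ?_)⟩
  · rw [hAlt.neg_eq x, hform, hform, hX.1, hAlt.neg_eq]
  · have hXkx : X (k x) = 0 := hω.1 _ fun y => by
      obtain ⟨y, rfl⟩ := LinearMap.injective_iff_surjective.1 hk y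
      rw [← hform, hx, map_zero, LinearMap.zero_apply]
    exact (map_eq_zero_iff k hk).1 ((map_eq_zero_iff X hX.2).1 hXkx)

theorem joinedIn_skewReg_of_sigPos_eq (hAlt : ω.IsAlt) (hω : ω.Nondegenerate)
    (hX : X ∈ skewReg ω) (hY : Y ∈ skewReg ω)
    (h : sigPos (skewQuad ω X) = sigPos (skewQuad ω Y)) : JoinedIn (skewReg ω) X Y := by
  have hsep : ∀ {Z}, Z ∈ skewReg ω →
      (QuadraticMap.associated (R := ℝ) (skewQuad ω Z)).SeparatingLeft := fun hZ => by
    rw [associated_skewQuad hAlt hZ.1]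
    exact separatingLeft_compLeft hω.1 hZ.2
  obtain ⟨e⟩ := equivalent_of_sigPos_eq (hsep hX) (hsep hY) h
  obtain ⟨v, hv⟩ := LinearMap.BilinForm.exists_orthogonal_basis (B := ω.compLeft Y)
    ⟨(isSymm_compLeft hAlt hY.1).eq⟩
  let g : End ℝ H := e.toLinearEquiv.toLinearMap
  obtain ⟨ε, hε, hjoin⟩ := exists_joinedIn_injective_diagonal_sign v (g := g)
    e.toLinearEquiv.injective
  have hcont : Continuous fun k : End ℝ H => formAdjoint ω hω k * Y * k :=
    ((IsModuleTopology.continuous_of_linearMap _).mul continuous_const).mul continuous_id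
  have hstart : formAdjoint ω hω g * Y * g = X := by
    have hQ : (skewQuad ω Y).comp g = skewQuad ω X := QuadraticMap.ext e.map_app
    apply compLeft_injective hω.1
    rw [compLeft_formAdjoint_mul_mul, ← associated_skewQuad hAlt hY.1,
      ← associated_skewQuad hAlt hX.1, ← QuadraticMap.associated_comp, hQ]
  have hend : formAdjoint ω hω (Matrix.toLin v v (Matrix.diagonal ε)) * Y *
      Matrix.toLin v v (Matrix.diagonal ε) = Y := by
    apply compLeft_injective hω.1
    rw [compLeft_formAdjoint_mul_mul, compl₁₂_toLin_diagonal hv hε]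
  have hmap := hjoin.map hcont
  rw [hstart, hend] at hmap
  refine hmap.mono ?_
  rintro _ ⟨k, hk, rfl⟩
  exact formAdjoint_mul_mul_mem_skewReg hAlt hω hY hk

end SkewPaths

section SigPosProd

variable {V W : Type*} [AddCommGroup V] [Module ℝ V] [AddCommGroup W] [Module ℝ W]

theorem prod_radical_le_radical_prod (Q : QuadraticForm ℝ V) (Q' : QuadraticForm ℝ W) :
    Q.radical.prod Q'.radical ≤ (Q.prod Q').radical := by
  rintro ⟨x, y⟩ ⟨hx, hy⟩
  rw [SetLike.mem_coe, QuadraticMap.mem_radical_iff'] at hx hy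
  rw [QuadraticMap.mem_radical_iff']
  exact ⟨by simp_all, fun z => by simp_all⟩

variable [FiniteDimensional ℝ V]

theorem one_le_sigPos {Q : QuadraticForm ℝ V} {v : V} (hv : 0 < Q v) : 1 ≤ sigPos Q := by
  have hv0 : v ≠ 0 := by
    rintro rfl
    exact hv.ne' (map_zero Q)
  rw [← finrank_span_singleton (K := ℝ) hv0]
  refine le_sigPos_of_posDef _ ?_
  rintro ⟨_, hx⟩ hne
  obtain ⟨r, rfl⟩ := Submodule.mem_span_singleton.1 hx
  have hr : r ≠ 0 := by
    rintro rfl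
    exact hne (Subtype.ext (zero_smul ℝ v))
  change 0 < Q (r • v)
  rw [QuadraticMap.map_smul]
  exact mul_pos (mul_self_pos.2 hr) hv

variable [FiniteDimensional ℝ W]

theorem finrank_submodule_prod (P : Submodule ℝ V) (P' : Submodule ℝ W) :
    finrank ℝ (P.prod P') = finrank ℝ P + finrank ℝ P' := by
  have hinj : Function.Injective (P.subtype.prodMap P'.subtype) :=
    P.injective_subtype.prodMap P'.injective_subtype
  have hrange : LinearMap.range (P.subtype.prodMap P'.subtype) = P.prod P' := by
    rw [LinearMap.range_prodMap, P.range_subtype, P'.range_subtype]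
  rw [← hrange, LinearMap.finrank_range_of_inj hinj, finrank_prod]

variable (Q : QuadraticForm ℝ V) (Q' : QuadraticForm ℝ W)

theorem sigPos_add_le_sigPos_prod : sigPos Q + sigPos Q' ≤ sigPos (Q.prod Q') := by
  obtain ⟨P, hP, hPpos⟩ := exists_finrank_eq_sigPos_and_posDef Q
  obtain ⟨P', hP', hPpos'⟩ := exists_finrank_eq_sigPos_and_posDef Q'
  rw [← hP, ← hP', ← finrank_submodule_prod]
  refine le_sigPos_of_posDef _ ?_
  rintro ⟨⟨x, y⟩, hx, hy⟩ hne
  refine hPpos.prod hPpos' (⟨x, hx⟩, ⟨y, hy⟩) fun h => hne ?_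
  rw [Prod.mk_eq_zero, Submodule.mk_eq_zero, Submodule.mk_eq_zero] at h
  exact Subtype.ext (Prod.ext h.1 h.2)

theorem sigPos_prod : sigPos (Q.prod Q') = sigPos Q + sigPos Q' := by
  have hpos := sigPos_add_le_sigPos_prod Q Q'
  have hneg := sigPos_add_le_sigPos_prod (-Q) (-Q')
  have hprod : (-Q).prod (-Q') = -Q.prod Q' := QuadraticMap.ext fun x => (neg_add _ _).symm
  rw [hprod] at hneg
  simp only [sigPos_neg] at hneg
  have hrad := Submodule.finrank_mono (prod_radical_le_radical_prod Q Q')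
  rw [finrank_submodule_prod] at hrad
  have hQ := QuadraticForm.sigPos_add_sigNeg_add_radical (Q := Q)
  have hQ' := QuadraticForm.sigPos_add_sigNeg_add_radical (Q := Q')
  have hsum := QuadraticForm.sigPos_add_sigNeg_add_radical (Q := Q.prod Q')
  rw [finrank_prod] at hsum
  omega

theorem sigPos_smul_linMulLin_fst_snd {r : ℝ} (hr : 0 < r) :
    sigPos (r • QuadraticMap.linMulLin (LinearMap.fst ℝ ℝ ℝ) (LinearMap.snd ℝ ℝ ℝ)) = 1 := by
  set Q := r • QuadraticMap.linMulLin (LinearMap.fst ℝ ℝ ℝ) (LinearMap.snd ℝ ℝ ℝ) with hQ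
  have hpos : 1 ≤ sigPos Q := one_le_sigPos (v := (1, 1)) (by simp [hQ, hr])
  have hneg : 1 ≤ sigPos (-Q) := one_le_sigPos (v := (1, -1)) (by simp [hQ, hr])
  have hsum := QuadraticForm.sigPos_add_sigNeg_add_radical (Q := Q)
  rw [sigPos_neg] at hneg
  rw [finrank_prod, finrank_self] at hsum
  omega

end SigPosProd

section PlaneSum

variable {W : Type*} [AddCommGroup W] [Module ℝ W] {ω : LinearMap.BilinForm ℝ W} {Y Y' : End ℝ W}
  {c : ℝ}

/-- The orthogonal sum of the standard symplectic plane and a form. -/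
noncomputable def planeSum (ω : LinearMap.BilinForm ℝ W) : LinearMap.BilinForm ℝ ((ℝ × ℝ) × W) :=
  LinearMap.mk₂ ℝ (fun p q => p.1.1 * q.1.2 - p.1.2 * q.1.1 + ω p.2 q.2)
    (fun p p' q => by simp; ring) (fun c p q => by simp; ring) (fun p q q' => by simp; ring)
    (fun c p q => by simp; ring)

@[simp]
theorem planeSum_apply (ω : LinearMap.BilinForm ℝ W) (p q : (ℝ × ℝ) × W) :
    planeSum ω p q = p.1.1 * q.1.2 - p.1.2 * q.1.1 + ω p.2 q.2 := rfl

/-- The endomorphism `diag(c, -c)` of the symplectic plane, extended by `Y`. -/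
noncomputable def hypSum (c : ℝ) (Y : End ℝ W) : End ℝ ((ℝ × ℝ) × W) :=
  LinearMap.prodMap (LinearMap.prodMap (c • LinearMap.id) ((-c) • LinearMap.id)) Y

@[simp]
theorem hypSum_apply (c : ℝ) (Y : End ℝ W) (p : (ℝ × ℝ) × W) :
    hypSum c Y p = ((c * p.1.1, -c * p.1.2), Y p.2) := rfl

theorem one_sub_hypSum (c : ℝ) (Y : End ℝ W) :
    (1 - hypSum c Y : End ℝ ((ℝ × ℝ) × W)) = LinearMap.prodMap
      (LinearMap.prodMap ((1 - c) • LinearMap.id) ((1 + c) • LinearMap.id)) (1 - Y) := by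
  ext <;> simp

theorem injective_prodMap_smul {a b : ℝ} (ha : a ≠ 0) (hb : b ≠ 0) (hY : Function.Injective Y) :
    Function.Injective (LinearMap.prodMap (LinearMap.prodMap (a • (LinearMap.id : End ℝ ℝ))
      (b • (LinearMap.id : End ℝ ℝ))) Y) :=
  ((smul_right_injective ℝ ha).prodMap (smul_right_injective ℝ hb)).prodMap hY

theorem hypSum_mem_skewReg (hY : Y ∈ skewReg ω) (hc : c ≠ 0) :
    hypSum c Y ∈ skewReg (planeSum ω) := by
  refine ⟨fun p q => ?_, injective_prodMap_smul hc (neg_ne_zero.2 hc) hY.2⟩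
  simp only [planeSum_apply, hypSum_apply, hY.1 p.2 q.2]
  ring

theorem injective_one_sub_hypSum (hY : Function.Injective (1 - Y : End ℝ W)) (hc : c ≠ 1)
    (hc' : c ≠ -1) : Function.Injective (1 - hypSum c Y : End ℝ ((ℝ × ℝ) × W)) := by
  rw [one_sub_hypSum]
  exact injective_prodMap_smul (sub_ne_zero.2 hc.symm) (fun h => hc' (by linarith)) hY

theorem hypSum_mem_cayleyDomain (hY : Y ∈ cayleyDomain ω) (h0 : c ≠ 0) (h1 : c ≠ 1)
    (h1' : c ≠ -1) : hypSum c Y ∈ cayleyDomain (planeSum ω) :=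
  ⟨hypSum_mem_skewReg hY.1 h0, injective_one_sub_hypSum hY.2 h1 h1'⟩

theorem skewQuad_hypSum (ω : LinearMap.BilinForm ℝ W) (c : ℝ) (Y : End ℝ W) :
    skewQuad (planeSum ω) (hypSum c Y) =
      ((2 * c) • QuadraticMap.linMulLin (LinearMap.fst ℝ ℝ ℝ) (LinearMap.snd ℝ ℝ ℝ)).prod
        (skewQuad ω Y) := by
  ext p
  simp only [skewQuad_apply, planeSum_apply, hypSum_apply, QuadraticMap.prod_apply,
    smul_apply, QuadraticMap.linMulLin_apply, LinearMap.fst_apply,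
    LinearMap.snd_apply, smul_eq_mul]
  ring

variable [FiniteDimensional ℝ W]

theorem det_one_sub_hypSum (c : ℝ) (Y : End ℝ W) :
    LinearMap.det (1 - hypSum c Y) = (1 - c) * (1 + c) * LinearMap.det (1 - Y) := by
  rw [one_sub_hypSum, LinearMap.det_prodMap, LinearMap.det_prodMap]
  simp

theorem sigPos_skewQuad_hypSum (ω : LinearMap.BilinForm ℝ W) (Y : End ℝ W) (hc : 0 < c) :
    sigPos (skewQuad (planeSum ω) (hypSum c Y)) = sigPos (skewQuad ω Y) + 1 := by
  rw [skewQuad_hypSum, sigPos_prod, sigPos_smul_linMulLin_fst_snd (by positivity), add_comm]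

attribute [local instance] endTopology isModuleTopology_end isTopologicalRing_end

theorem continuous_hypSum (c : ℝ) : Continuous (hypSum c : End ℝ W → End ℝ ((ℝ × ℝ) × W)) := by
  let P : End ℝ ((ℝ × ℝ) × W) := hypSum c 0
  have h : ∀ Y : End ℝ W, hypSum c Y =
      P + LinearMap.prodMapLinear ℝ (ℝ × ℝ) W (ℝ × ℝ) W ℝ (0, Y) := fun Y => by
    ext <;> simp [P]
  rw [funext h]
  exact continuous_const.add (IsModuleTopology.continuous_of_linearMap
    (LinearMap.prodMapLinear ℝ (ℝ × ℝ) W (ℝ × ℝ) W ℝ ∘ₗ LinearMap.inr ℝ _ _))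

theorem joinedIn_hypSum (h : JoinedIn (cayleyDomain ω) Y Y') (h0 : c ≠ 0) (h1 : c ≠ 1)
    (h1' : c ≠ -1) : JoinedIn (cayleyDomain (planeSum ω)) (hypSum c Y) (hypSum c Y') := by
  refine (h.map (continuous_hypSum c)).mono ?_
  rintro _ ⟨Y, hY, rfl⟩
  exact hypSum_mem_cayleyDomain hY h0 h1 h1'

end PlaneSum

section Quadruple

variable {W : Type*} [AddCommGroup W] [Module ℝ W] {ω : LinearMap.BilinForm ℝ W} {Y Z : End ℝ W}
  {z w : ℂ}

/-- On two symplectic planes with coordinates `(a, b)` and `(c, d)`, multiplication of `a + ic` by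
`z` and of `b + id` by `w`, extended by `Y`. For `w = -conj z` it is infinitesimally symplectic with
eigenvalues `±z, ±conj z` on the planes. -/
noncomputable def quadSum (z w : ℂ) (Y : End ℝ W) : End ℝ ((ℝ × ℝ) × (ℝ × ℝ) × W) where
  toFun p :=
    (((z * ⟨p.1.1, p.2.1.1⟩).re, (w * ⟨p.1.2, p.2.1.2⟩).re),
      ((z * ⟨p.1.1, p.2.1.1⟩).im, (w * ⟨p.1.2, p.2.1.2⟩).im), Y p.2.2)
  map_add' p q := by ext <;> simp <;> ring
  map_smul' r p := by ext <;> simp <;> ring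

@[simp]
theorem quadSum_apply (z w : ℂ) (Y : End ℝ W) (p : (ℝ × ℝ) × (ℝ × ℝ) × W) :
    quadSum z w Y p = (((z * ⟨p.1.1, p.2.1.1⟩).re, (w * ⟨p.1.2, p.2.1.2⟩).re),
      ((z * ⟨p.1.1, p.2.1.1⟩).im, (w * ⟨p.1.2, p.2.1.2⟩).im), Y p.2.2) := rfl

theorem injective_quadSum (hz : z ≠ 0) (hw : w ≠ 0) (hY : Function.Injective Y) :
    Function.Injective (quadSum z w Y) := by
  rw [injective_iff_map_eq_zero]
  rintro ⟨⟨a, b⟩, ⟨c, d⟩, x⟩ h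
  simp only [quadSum_apply, Prod.mk_eq_zero] at h
  obtain ⟨⟨hre, hre'⟩, ⟨him, him'⟩, hx⟩ := h
  have hac := (mul_eq_zero.1 (Complex.ext hre him)).resolve_left hz
  have hbd := (mul_eq_zero.1 (Complex.ext hre' him')).resolve_left hw
  obtain ⟨rfl, rfl⟩ := Complex.ext_iff.1 hac
  obtain ⟨rfl, rfl⟩ := Complex.ext_iff.1 hbd
  rw [(map_eq_zero_iff Y hY).1 hx]
  rfl

theorem one_sub_quadSum (z w : ℂ) (Y : End ℝ W) :
    (1 - quadSum z w Y : End ℝ ((ℝ × ℝ) × (ℝ × ℝ) × W)) = quadSum (1 - z) (1 - w) (1 - Y) := by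
  ext <;> simp

theorem hypSum_hypSum_eq_quadSum (c : ℝ) (Y : End ℝ W) :
    hypSum c (hypSum c Y) = quadSum c (-conj (c : ℂ)) Y := by
  ext <;> simp

theorem quadSum_mem_cayleyDomain (hZ : Z ∈ cayleyDomain ω) (hz : z ∈ ({0, 1, -1} : Set ℂ)ᶜ) :
    quadSum z (-conj z) Z ∈ cayleyDomain (planeSum (planeSum ω)) := by
  simp only [Set.mem_compl_iff, Set.mem_insert_iff, Set.mem_singleton_iff, not_or] at hz
  obtain ⟨h0, h1, h1'⟩ := hz
  refine ⟨⟨fun p q => ?_, injective_quadSum h0 (by simpa using h0) hZ.1.2⟩, ?_⟩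
  · simp [hZ.1.1 p.2.2 q.2.2]
    ring
  · rw [one_sub_quadSum]
    refine injective_quadSum (sub_ne_zero.2 (Ne.symm h1)) (fun h => h1' ?_) hZ.2
    have hconj := congrArg conj h
    simp only [map_sub, map_one, map_neg, Complex.conj_conj, map_zero] at hconj
    linear_combination hconj

variable [FiniteDimensional ℝ W]

attribute [local instance] endTopology isModuleTopology_end isTopologicalRing_end

theorem continuous_quadSum (Y : End ℝ W) : Continuous fun z : ℂ => quadSum z (-conj z) Y := by
  have h : ∀ z : ℂ, quadSum z (-conj z) Y = quadSum 0 0 Y + z.re • quadSum 1 (-1) (0 : End ℝ W) +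
      z.im • quadSum Complex.I Complex.I (0 : End ℝ W) := fun z => by
    ext <;> simp
  rw [funext h]
  fun_prop

/-- Two hyperbolic planes with the eigenvalues `±2` are merged into a complex quadruple, which can
move around `1` to the eigenvalues `±1 / 2`. -/
theorem joinedIn_hypSum_hypSum (hZ : Z ∈ cayleyDomain ω) :
    JoinedIn (cayleyDomain (planeSum (planeSum ω))) (hypSum 2 (hypSum 2 Z))
      (hypSum (1 / 2) (hypSum (1 / 2) Z)) := by
  have hconn : IsPathConnected ({0, 1, -1} : Set ℂ)ᶜ :=
    (Set.toFinite _).countable.isPathConnected_compl_of_one_lt_rank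
      (by rw [Complex.rank_real_complex]; exact Nat.one_lt_ofNat)
  have hpath : JoinedIn ({0, 1, -1} : Set ℂ)ᶜ ((2 : ℝ) : ℂ) ((1 / 2 : ℝ) : ℂ) :=
    hconn.joinedIn _ (by norm_num) _ (by norm_num)
  rw [hypSum_hypSum_eq_quadSum, hypSum_hypSum_eq_quadSum]
  refine (hpath.map (continuous_quadSum Z)).mono ?_
  rintro _ ⟨z, hz, rfl⟩
  exact quadSum_mem_cayleyDomain hZ hz

end Quadruple

section PlaneCompression

variable {W : Type*} [AddCommGroup W] [Module ℝ W] {ω : LinearMap.BilinForm ℝ W}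
  {X T : End ℝ ((ℝ × ℝ) × W)}

/-- The block of an endomorphism on the complement `W` of the plane. -/
noncomputable def planeCompression (X : End ℝ ((ℝ × ℝ) × W)) : End ℝ W :=
  LinearMap.snd ℝ (ℝ × ℝ) W ∘ₗ X ∘ₗ LinearMap.inr ℝ (ℝ × ℝ) W

@[simp]
theorem planeCompression_apply (X : End ℝ ((ℝ × ℝ) × W)) (x : W) :
    planeCompression X x = (X ((0, 0), x)).2 := rfl

theorem planeCompression_mem_skewEnd (hX : X ∈ skewEnd (planeSum ω)) :
    planeCompression X ∈ skewEnd ω := fun x y => by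
  simpa using hX ((0, 0), x) ((0, 0), y)

/-- For the order `(1, 0)`, `W`, `(0, 1)` of the blocks, `T` is block triangular. -/
theorem injective_iff_injective_planeCompression {a b : ℝ} (ha : a ≠ 0) (hb : b ≠ 0)
    (hTa : T ((1, 0), 0) = ((a, 0), 0)) (hTb : ∀ p, (T p).1.2 = b * p.1.2) :
    Function.Injective T ↔ Function.Injective (planeCompression T) := by
  have hT : ∀ s x, T ((s, 0), x) = ((a * s + (T ((0, 0), x)).1.1, 0), planeCompression T x) := by
    intro s x
    have hdec : (((s, 0), x) : (ℝ × ℝ) × W) = s • ((1, 0), 0) + ((0, 0), x) := by simp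
    rw [hdec, map_add, map_smul, hTa]
    ext <;> simp [hTb, mul_comm]
  simp only [injective_iff_map_eq_zero]
  constructor
  · intro h x hx
    have h0 := h ((-(T ((0, 0), x)).1.1 / a, 0), x) (by
      rw [hT, hx, mul_div_cancel₀ _ ha, neg_add_cancel]
      rfl)
    exact congrArg Prod.snd h0
  · rintro h ⟨⟨s, t⟩, x⟩ hp
    have ht : b * t = 0 := by rw [← hTb ((s, t), x), hp]; rfl
    obtain rfl := (mul_eq_zero.1 ht).resolve_left hb
    rw [hT] at hp
    obtain rfl := h x (congrArg Prod.snd hp)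
    have hs : a * s + (T ((0, 0), 0)).1.1 = 0 := congrArg (fun p => p.1.1) hp
    have hT0 : T ((0, 0), 0) = 0 := map_zero T
    rw [hT0, Prod.fst_zero, Prod.fst_zero, add_zero] at hs
    rw [(mul_eq_zero.1 hs).resolve_left ha]
    rfl

theorem mem_cayleyDomain_iff_planeCompression (hX : X ∈ skewEnd (planeSum ω)) {μ : ℝ} (hμ : 1 < μ)
    (he : X ((1, 0), 0) = ((μ, 0), 0)) :
    X ∈ cayleyDomain (planeSum ω) ↔ planeCompression X ∈ cayleyDomain ω := by
  have hsnd : ∀ p, (X p).1.2 = -μ * p.1.2 := fun p => by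
    have h := hX ((1, 0), 0) p
    simp only [he, planeSum_apply, map_zero, LinearMap.zero_apply] at h
    linarith
  have hinj : Function.Injective X ↔ Function.Injective (planeCompression X) :=
    injective_iff_injective_planeCompression (by linarith) (by linarith) he hsnd
  have hinj_one_sub : Function.Injective (1 - X : End ℝ ((ℝ × ℝ) × W)) ↔
      Function.Injective (1 - planeCompression X : End ℝ W) := by
    have hcomp : (1 - planeCompression X : End ℝ W) = planeCompression (1 - X) := by ext x; simp
    rw [hcomp]
    refine injective_iff_injective_planeCompression (a := 1 - μ) (b := 1 + μ) (by linarith)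
      (by linarith) (by simp [he]) fun p => ?_
    simp only [LinearMap.sub_apply, Module.End.one_apply, Prod.fst_sub, Prod.snd_sub, hsnd]
    ring
  simp only [cayleyDomain, skewReg, Set.mem_ofPred_eq, hX, planeCompression_mem_skewEnd hX,
    true_and, hinj, hinj_one_sub]

attribute [local instance] endTopology isModuleTopology_end isTopologicalRing_end

theorem exists_joinedIn_hypSum [FiniteDimensional ℝ W] (hX : X ∈ cayleyDomain (planeSum ω)) {μ : ℝ}
    (hμ : 1 < μ) (he : X ((1, 0), 0) = ((μ, 0), 0)) :
    ∃ Y ∈ cayleyDomain ω, JoinedIn (cayleyDomain (planeSum ω)) X (hypSum 2 Y) := by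
  have hY := (mem_cayleyDomain_iff_planeCompression hX.1.1 hμ he).1 hX
  refine ⟨planeCompression X, hY, JoinedIn.ofLine
    (f := fun t => (1 - t) • X + t • hypSum 2 (planeCompression X))
    (Continuous.continuousOn (by fun_prop)) (by simp) (by simp) ?_⟩
  rintro _ ⟨t, ⟨ht0, ht1⟩, rfl⟩
  have hskew : (1 - t) • X + t • hypSum 2 (planeCompression X) ∈ skewEnd (planeSum ω) := by
    intro p q
    have h := (hypSum_mem_skewReg hY.1 (two_ne_zero' ℝ)).1 p q
    simp only [LinearMap.add_apply, LinearMap.smul_apply, map_add, map_smul, hX.1.1 p q, h,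
      smul_eq_mul]
    ring
  have hμt : 1 < (1 - t) * μ + t * 2 := by
    nlinarith [mul_nonneg (sub_nonneg.2 ht1) (sub_pos.2 hμ).le]
  refine (mem_cayleyDomain_iff_planeCompression hskew hμt ?_).2 ?_
  · have hX0 : X ((0, 0), 0) = 0 := map_zero X
    ext <;> simp [he, hX0]
  · convert hY using 1
    ext x
    simp
    module

end PlaneCompression

section Isometries

variable {H K : Type*} [AddCommGroup H] [Module ℝ H] [AddCommGroup K] [Module ℝ K]
  {ω : LinearMap.BilinForm ℝ H} {ω' : LinearMap.BilinForm ℝ K} {X X' : End ℝ H} {c : ℝ}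

/-- The injective infinitesimally symplectic endomorphisms without real eigenvalues `≥ 1`. They can
be scaled down within the domain of the Cayley transform. -/
def shrinkable (ω : LinearMap.BilinForm ℝ H) : Set (End ℝ H) :=
  {X | X ∈ skewReg ω ∧ ∀ t ∈ Set.Ioc (0 : ℝ) 1, Function.Injective (1 - t • X : End ℝ H)}

theorem shrinkable_subset_cayleyDomain : shrinkable ω ⊆ cayleyDomain ω := fun X hX =>
  ⟨hX.1, by simpa only [one_smul] using hX.2 1 ⟨one_pos, le_rfl⟩⟩

theorem smul_mem_skewReg (hX : X ∈ skewReg ω) (hc : c ≠ 0) : c • X ∈ skewReg ω :=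
  ⟨fun x y => by simp [hX.1 x y], (smul_right_injective H hc).comp hX.2⟩

theorem hypSum_mem_shrinkable (hX : X ∈ shrinkable ω) (h0 : 0 < c) (h1 : c < 1) :
    hypSum c X ∈ shrinkable (planeSum ω) := by
  refine ⟨hypSum_mem_skewReg hX.1 h0.ne', fun t ht => ?_⟩
  have hsmul : t • hypSum c X = hypSum (t * c) (t • X) := by ext <;> simp
  have htc : 0 < t * c := mul_pos ht.1 h0
  rw [hsmul]
  exact injective_one_sub_hypSum (hX.2 t ht) (mul_lt_one_of_nonneg_of_lt_one_right ht.2 h0.le h1).ne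
    (by linarith)

variable {φ : H ≃ₗ[ℝ] K}

theorem one_sub_smul_conj (t : ℝ) (X : End ℝ H) :
    (1 - t • φ.conj X : End ℝ K) = φ.conj (1 - t • X) := by
  ext x
  simp [LinearEquiv.conj_apply]

theorem one_sub_conj (X : End ℝ H) : (1 - φ.conj X : End ℝ K) = φ.conj (1 - X) := by
  simpa only [one_smul] using one_sub_smul_conj (φ := φ) 1 X

theorem injective_conj (hX : Function.Injective X) : Function.Injective (φ.conj X) := by
  rw [LinearEquiv.conj_apply]
  exact (φ.injective.comp hX).comp φ.symm.injective

theorem conj_mem_skewReg (hφ : ∀ x y, ω' (φ x) (φ y) = ω x y) (hX : X ∈ skewReg ω) :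
    φ.conj X ∈ skewReg ω' := by
  refine ⟨φ.surjective.forall₂.2 fun x y => ?_, injective_conj hX.2⟩
  simp [LinearEquiv.conj_apply, hφ, hX.1 x y]

theorem conj_mem_cayleyDomain (hφ : ∀ x y, ω' (φ x) (φ y) = ω x y) (hX : X ∈ cayleyDomain ω) :
    φ.conj X ∈ cayleyDomain ω' :=
  ⟨conj_mem_skewReg hφ hX.1, by rw [one_sub_conj]; exact injective_conj hX.2⟩

theorem conj_mem_shrinkable (hφ : ∀ x y, ω' (φ x) (φ y) = ω x y) (hX : X ∈ shrinkable ω) :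
    φ.conj X ∈ shrinkable ω' :=
  ⟨conj_mem_skewReg hφ hX.1, fun t ht => by
    rw [one_sub_smul_conj]
    exact injective_conj (hX.2 t ht)⟩

theorem isometry_symm (hφ : ∀ x y, ω' (φ x) (φ y) = ω x y) (x y : K) :
    ω (φ.symm x) (φ.symm y) = ω' x y := by
  rw [← hφ, φ.apply_symm_apply, φ.apply_symm_apply]

theorem sigPos_skewQuad_conj (hφ : ∀ x y, ω' (φ x) (φ y) = ω x y) (X : End ℝ H) :
    sigPos (skewQuad ω' (φ.conj X)) = sigPos (skewQuad ω X) := by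
  refine (QuadraticMap.Equivalent.sigPos_eq ⟨⟨φ, fun x => ?_⟩⟩).symm
  change ω' (φ.conj X (φ x)) (φ x) = ω (X x) x
  simp [LinearEquiv.conj_apply, hφ]

theorem det_one_sub_conj (X : End ℝ H) :
    LinearMap.det (1 - φ.conj X) = LinearMap.det (1 - X) := by
  rw [one_sub_conj, LinearEquiv.conj_apply, LinearMap.comp_assoc]
  exact LinearMap.det_conj _ φ

attribute [local instance] endTopology isModuleTopology_end isTopologicalRing_end

theorem joinedIn_conj [FiniteDimensional ℝ K] (hφ : ∀ x y, ω' (φ x) (φ y) = ω x y)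
    (h : JoinedIn (cayleyDomain ω) X X') :
    JoinedIn (cayleyDomain ω') (φ.conj X) (φ.conj X') := by
  have hc : Continuous (φ.conj : End ℝ H → End ℝ K) :=
    IsModuleTopology.continuous_of_linearMap φ.conj.toLinearMap
  refine (h.map hc).mono ?_
  rintro _ ⟨X, hX, rfl⟩
  exact conj_mem_cayleyDomain hφ hX

end Isometries

section PlaneSplitting

/-- An orthogonal splitting of `(H, ω)` into a standard symplectic plane and a subspace `W` carrying
the form `form`. -/
structure PlaneSplitting {H : Type*} [AddCommGroup H] [Module ℝ H]
    (ω : LinearMap.BilinForm ℝ H) where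
  W : Submodule ℝ H
  form : LinearMap.BilinForm ℝ W
  equiv : H ≃ₗ[ℝ] (ℝ × ℝ) × W
  isometry : ∀ x y, planeSum form (equiv x) (equiv y) = ω x y

namespace PlaneSplitting

variable {H : Type*} [AddCommGroup H] [Module ℝ H] {ω : LinearMap.BilinForm ℝ H}
  (S : PlaneSplitting ω) (T : PlaneSplitting S.form) {Y Y' : End ℝ S.W} {Z : End ℝ T.W} {c d : ℝ}

/-- The endomorphism that is `diag(c, -c)` on the symplectic plane and `Y` on its complement. -/
noncomputable def extend (c : ℝ) (Y : End ℝ S.W) : End ℝ H := S.equiv.symm.conj (hypSum c Y)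

theorem form_apply (x y : S.W) :
    S.form x y = ω (S.equiv.symm (0, x)) (S.equiv.symm (0, y)) := by
  simp [isometry_symm S.isometry]

theorem isAlt (hAlt : ω.IsAlt) : S.form.IsAlt := fun x => by
  rw [form_apply, hAlt]

theorem nondegenerate (hAlt : ω.IsAlt) (hω : ω.Nondegenerate) : S.form.Nondegenerate := by
  refine (S.isAlt hAlt).isRefl.nondegenerate_iff_separatingLeft.2 fun x hx => ?_
  have h0 : S.equiv.symm (0, x) = 0 := hω.1 _ fun y => by
    rw [← S.isometry, S.equiv.apply_symm_apply]
    simp [hx]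
  exact congrArg Prod.snd ((LinearEquiv.map_eq_zero_iff S.equiv.symm).1 h0)

theorem extend_mem_cayleyDomain (hY : Y ∈ cayleyDomain S.form) (h0 : c ≠ 0) (h1 : c ≠ 1)
    (h1' : c ≠ -1) : S.extend c Y ∈ cayleyDomain ω :=
  conj_mem_cayleyDomain (isometry_symm S.isometry) (hypSum_mem_cayleyDomain hY h0 h1 h1')

theorem extend_mem_shrinkable (hY : Y ∈ shrinkable S.form) (h0 : 0 < c) (h1 : c < 1) :
    S.extend c Y ∈ shrinkable ω :=
  conj_mem_shrinkable (isometry_symm S.isometry) (hypSum_mem_shrinkable hY h0 h1)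

/-- The splitting of `H` into two symplectic planes and the rest. -/
noncomputable def equivTwoPlanes : H ≃ₗ[ℝ] (ℝ × ℝ) × (ℝ × ℝ) × T.W :=
  S.equiv.trans ((LinearEquiv.refl ℝ (ℝ × ℝ)).prodCongr T.equiv)

theorem planeSum_planeSum_equivTwoPlanes (x y : H) :
    planeSum (planeSum T.form) (S.equivTwoPlanes T x) (S.equivTwoPlanes T y) = ω x y := by
  rw [← S.isometry, planeSum_apply, planeSum_apply S.form, ← T.isometry]
  rfl

theorem extend_extend (c d : ℝ) (Z : End ℝ T.W) :
    S.extend c (T.extend d Z) = (S.equivTwoPlanes T).symm.conj (hypSum c (hypSum d Z)) := rfl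

variable [FiniteDimensional ℝ H]

theorem finrank_eq : finrank ℝ H = finrank ℝ S.W + 2 := by
  rw [S.equiv.finrank_eq, finrank_prod, finrank_prod, finrank_self]
  ring

theorem sigPos_skewQuad_extend (Y : End ℝ S.W) (hc : 0 < c) :
    sigPos (skewQuad ω (S.extend c Y)) = sigPos (skewQuad S.form Y) + 1 := by
  rw [extend, sigPos_skewQuad_conj (isometry_symm S.isometry), sigPos_skewQuad_hypSum _ _ hc]

theorem sign_det_one_sub_extend (Y : End ℝ S.W) (hc : 1 < c) :
    SignType.sign (LinearMap.det (1 - S.extend c Y)) =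
      -SignType.sign (LinearMap.det (1 - Y)) := by
  have hneg : (1 - c) * (1 + c) < 0 := mul_neg_of_neg_of_pos (by linarith) (by linarith)
  rw [extend, det_one_sub_conj, det_one_sub_hypSum, sign_mul, sign_neg hneg, neg_one_mul]

attribute [local instance] endTopology isModuleTopology_end isTopologicalRing_end

theorem joinedIn_extend (h : JoinedIn (cayleyDomain S.form) Y Y') (h0 : c ≠ 0) (h1 : c ≠ 1)
    (h1' : c ≠ -1) : JoinedIn (cayleyDomain ω) (S.extend c Y) (S.extend c Y') :=
  joinedIn_conj (isometry_symm S.isometry) (joinedIn_hypSum h h0 h1 h1')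

theorem joinedIn_extend_extend (hZ : Z ∈ cayleyDomain T.form) :
    JoinedIn (cayleyDomain ω) (S.extend 2 (T.extend 2 Z))
      (S.extend (1 / 2) (T.extend (1 / 2) Z)) := by
  rw [extend_extend, extend_extend]
  exact joinedIn_conj (isometry_symm (S.planeSum_planeSum_equivTwoPlanes T))
    (joinedIn_hypSum_hypSum hZ)

theorem exists_joinedIn_extend {X : End ℝ H} (hX : X ∈ cayleyDomain ω) {e : H}
    (he : S.equiv e = ((1, 0), 0)) {μ : ℝ} (hμ : 1 < μ) (hXe : X e = μ • e) :
    ∃ Y ∈ cayleyDomain S.form, JoinedIn (cayleyDomain ω) X (S.extend 2 Y) := by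
  have hconj : S.equiv.conj X ((1, 0), 0) = ((μ, 0), 0) := by
    rw [LinearEquiv.conj_apply_apply, ← he, S.equiv.symm_apply_apply, hXe, map_smul, he]
    simp
  obtain ⟨Y, hY, hXY⟩ := exists_joinedIn_hypSum (conj_mem_cayleyDomain S.isometry hX) hμ hconj
  refine ⟨Y, hY, ?_⟩
  have hXX : S.equiv.symm.conj (S.equiv.conj X) = X := S.equiv.conj.symm_apply_apply X
  rw [← hXX]
  exact joinedIn_conj (isometry_symm S.isometry) hXY

end PlaneSplitting

end PlaneSplitting

section HyperbolicPair

variable {H : Type*} [AddCommGroup H] [Module ℝ H] {ω : LinearMap.BilinForm ℝ H} {e f : H}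

/-- The orthogonal complement of the plane spanned by `e` and `f`. -/
noncomputable def planeComplement (ω : LinearMap.BilinForm ℝ H) (e f : H) : Submodule ℝ H :=
  LinearMap.ker (ω e) ⊓ LinearMap.ker (ω f)

theorem sub_sub_mem_planeComplement (hAlt : ω.IsAlt) (hef : ω e f = 1) (x : H) :
    x - ω x f • e - ω e x • f ∈ planeComplement ω e f := by
  have hfe : ω f e = -1 := by rw [← hAlt.neg_eq, hef]
  refine ⟨?_, ?_⟩
  · simp [hAlt e, hef]
  · simp [hAlt f, hfe, ← hAlt.neg_eq x f]

/-- The splitting of a hyperbolic pair `e`, `f`, in the coordinates dual to it. -/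
noncomputable def hyperbolicEquiv (hAlt : ω.IsAlt) (hef : ω e f = 1) :
    H ≃ₗ[ℝ] (ℝ × ℝ) × planeComplement ω e f where
  toFun x := ((ω x f, ω e x), ⟨x - ω x f • e - ω e x • f, sub_sub_mem_planeComplement hAlt hef x⟩)
  map_add' x y := by
    refine Prod.ext (by simp) (Subtype.ext ?_)
    simp
    module
  map_smul' c x := by
    refine Prod.ext (by simp) (Subtype.ext ?_)
    simp
    module
  invFun p := p.1.1 • e + p.1.2 • f + (p.2 : H)
  left_inv x := by simp
  right_inv := by
    rintro ⟨⟨a, b⟩, ⟨w, hwe, hwf⟩⟩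
    rw [SetLike.mem_coe, LinearMap.mem_ker] at hwe hwf
    have hwf' : ω w f = 0 := by rw [← hAlt.neg_eq, hwf, neg_zero]
    refine Prod.ext (by simp [hAlt e, hAlt f, hef, hwe, hwf']) (Subtype.ext ?_)
    simp [hAlt e, hAlt f, hef, hwe, hwf']
    abel

/-- The splitting determined by a hyperbolic pair. -/
noncomputable def hyperbolicSplitting (hAlt : ω.IsAlt) (hef : ω e f = 1) : PlaneSplitting ω where
  W := planeComplement ω e f
  form := ω.restrict (planeComplement ω e f)
  equiv := hyperbolicEquiv hAlt hef
  isometry x y := by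
    have hfe : ω f e = -1 := by rw [← hAlt.neg_eq, hef]
    simp [hyperbolicEquiv, hAlt e, hAlt f, hef, hfe, ← hAlt.neg_eq f, ← hAlt.neg_eq e x]
    ring

theorem hyperbolicSplitting_equiv_left (hAlt : ω.IsAlt) (hef : ω e f = 1) :
    (hyperbolicSplitting hAlt hef).equiv e = ((1, 0), 0) := by
  change ((ω e f, ω e e), (⟨e - ω e f • e - ω e e • f, _⟩ : planeComplement ω e f)) = _
  refine Prod.ext (by simp [hAlt e, hef]) (Subtype.ext ?_)
  simp [hAlt e, hef]

theorem exists_apply_eq_one (hω : ω.SeparatingLeft) (he : e ≠ 0) : ∃ f, ω e f = 1 := by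
  by_contra! h
  refine he (hω e fun y => ?_)
  by_contra hy
  exact h ((ω e y)⁻¹ • y) (by simp [hy])

theorem exists_planeSplitting (hAlt : ω.IsAlt) (hω : ω.SeparatingLeft) (he : e ≠ 0) :
    ∃ S : PlaneSplitting ω, S.equiv e = ((1, 0), 0) :=
  have ⟨_, hef⟩ := exists_apply_eq_one hω he
  ⟨hyperbolicSplitting hAlt hef, hyperbolicSplitting_equiv_left hAlt hef⟩

theorem exists_eigenvector_of_not_injective {X : End ℝ H} {t : ℝ} (ht0 : t ≠ 0)
    (ht : ¬ Function.Injective (1 - t • X : End ℝ H)) : ∃ e, e ≠ 0 ∧ X e = t⁻¹ • e := by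
  simp only [injective_iff_map_eq_zero, not_forall] at ht
  obtain ⟨e, he, he0⟩ := ht
  refine ⟨e, he0, ?_⟩
  rw [eq_inv_smul_iff₀ ht0]
  exact (sub_eq_zero.1 he).symm

end HyperbolicPair

section LocalConstancy

attribute [local instance] endTopology isModuleTopology_end isTopologicalRing_end

variable {H : Type*} [AddCommGroup H] [Module ℝ H] [FiniteDimensional ℝ H]
  {ω : LinearMap.BilinForm ℝ H} {X X' : End ℝ H}

theorem isLocallyConstant_sign_det_one_sub :
    IsLocallyConstant fun X : cayleyDomain ω => SignType.sign (LinearMap.det (1 - X.1)) := by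
  have hc : Continuous fun X : cayleyDomain ω => LinearMap.det (1 - X.1) :=
    continuous_det_end.comp (continuous_const.sub continuous_subtype_val)
  refine (IsLocallyConstant.iff_continuous _).2 (continuous_iff_continuousAt.2 fun X => ?_)
  exact ContinuousAt.comp (g := SignType.sign)
    (continuousAt_sign_of_ne_zero (injective_iff_det_ne_zero.1 X.2.2)) hc.continuousAt

theorem isLocallyConstant_sigPos_skewQuad (hAlt : ω.IsAlt) (hω : ω.Nondegenerate) :
    IsLocallyConstant fun X : cayleyDomain ω => sigPos (skewQuad ω X.1) := by
  have hc : ∀ x y, Continuous fun X : cayleyDomain ω => ω.compLeft X.1 x y := fun x y =>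
    (IsModuleTopology.continuous_of_linearMap (ω.flip y ∘ₗ LinearMap.applyₗ x)).comp
      continuous_subtype_val
  have hsig := isLocallyConstant_hermitianSignature
    (fun X : cayleyDomain ω => isSymm_sesqExt (isSymm_compLeft hAlt X.2.1.1))
    (continuous_sesqExt hc)
    (fun X => nondegenerateOn_top_sesqExt (separatingLeft_compLeft hω.1 X.2.1.2))
  convert hsig.comp fun k => ((finrank ℝ H + k) / 2).toNat using 1
  funext X
  have h := hermitianSignature_sesqExt (isSymm_compLeft hAlt X.2.1.1)
    (separatingLeft_compLeft hω.1 X.2.1.2)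
  have h' := sigPos_add_sigNeg_skewQuad hAlt hω X.2.1
  rw [Function.comp_apply, h]
  simp only [skewQuad] at h' ⊢
  omega

theorem eq_of_joinedIn {α Y : Type*} [TopologicalSpace Y] {F : Set Y} {x y : Y} {f : Y → α}
    (hf : IsLocallyConstant fun x : F => f x) (h : JoinedIn F x y) : f x = f y := by
  obtain ⟨γ⟩ := h.joined_subtype
  simpa using (hf.comp_continuous γ.continuous).apply_eq_of_preconnectedSpace 0 1

theorem sign_det_one_sub_eq_of_joinedIn (h : JoinedIn (cayleyDomain ω) X X') :
    SignType.sign (LinearMap.det (1 - X)) = SignType.sign (LinearMap.det (1 - X')) :=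
  eq_of_joinedIn (f := fun X => SignType.sign (LinearMap.det (1 - X)))
    isLocallyConstant_sign_det_one_sub h

theorem sigPos_skewQuad_eq_of_joinedIn (hAlt : ω.IsAlt) (hω : ω.Nondegenerate)
    (h : JoinedIn (cayleyDomain ω) X X') : sigPos (skewQuad ω X) = sigPos (skewQuad ω X') :=
  eq_of_joinedIn (f := fun X => sigPos (skewQuad ω X)) (isLocallyConstant_sigPos_skewQuad hAlt hω) h

end LocalConstancy

section Shrinking

attribute [local instance] endTopology isModuleTopology_end isTopologicalRing_end

variable {H : Type*} [AddCommGroup H] [Module ℝ H] {ω : LinearMap.BilinForm ℝ H}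
  {X X' : End ℝ H} {ε : ℝ}

theorem joinedIn_smul_of_mem_shrinkable (hX : X ∈ shrinkable ω) (h0 : 0 < ε) (h1 : ε ≤ 1) :
    JoinedIn (cayleyDomain ω) X (ε • X) := by
  refine JoinedIn.ofLine (f := fun t => (1 - t + t * ε) • X)
    (Continuous.continuousOn (by fun_prop)) (by simp) (by simp) ?_
  rintro _ ⟨t, ⟨ht0, ht1⟩, rfl⟩
  have hpos : 0 < 1 - t + t * ε := by
    rcases ht1.eq_or_lt with rfl | h
    · linarith
    · nlinarith [mul_nonneg ht0 h0.le]
  exact ⟨smul_mem_skewReg hX.1 hpos.ne', hX.2 _ ⟨hpos, by nlinarith⟩⟩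

variable [FiniteDimensional ℝ H]

theorem eventually_det_one_sub_smul_pos (X : End ℝ H) :
    ∀ᶠ s in 𝓝[>] (0 : ℝ), 0 < LinearMap.det (1 - s • X) := by
  have hc : Continuous fun s : ℝ => LinearMap.det (1 - s • X) :=
    continuous_det_end.comp (by fun_prop)
  have h0 : ∀ᶠ s in 𝓝 (0 : ℝ), 0 < LinearMap.det (1 - s • X) :=
    hc.continuousAt.eventually (lt_mem_nhds (by simp))
  exact h0.filter_mono nhdsWithin_le_nhds

theorem exists_joinedIn_smul_smul (h : JoinedIn (skewReg ω) X X') :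
    ∃ ε : ℝ, 0 < ε ∧ ε ≤ 1 ∧ JoinedIn (cayleyDomain ω) (ε • X) (ε • X') := by
  obtain ⟨γ, hγ⟩ := h
  have hc : Continuous fun p : ℝ × unitInterval => LinearMap.det (1 - p.1 • γ p.2) := by
    have : Continuous fun p : ℝ × unitInterval => γ p.2 := γ.continuous.comp continuous_snd
    exact continuous_det_end.comp (by fun_prop)
  have hev : ∀ᶠ s in 𝓝 (0 : ℝ), ∀ t ∈ Set.univ, LinearMap.det (1 - s • γ t) ≠ 0 :=
    isCompact_univ.eventually_forall_of_forall_eventually fun t _ =>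
      hc.continuousAt.eventually_ne (by simp)
  obtain ⟨ε, hdet, h0, h1⟩ :=
    ((hev.filter_mono nhdsWithin_le_nhds).and (Ioc_mem_nhdsGT (zero_lt_one' ℝ))).exists
  exact ⟨ε, h0, h1, γ.map (continuous_const_smul ε), fun t =>
    ⟨smul_mem_skewReg (hγ t) h0.ne', injective_iff_det_ne_zero.2 (hdet t trivial)⟩⟩

theorem joinedIn_of_mem_shrinkable (hAlt : ω.IsAlt) (hω : ω.Nondegenerate) (hX : X ∈ shrinkable ω)
    (hX' : X' ∈ shrinkable ω) (h : sigPos (skewQuad ω X) = sigPos (skewQuad ω X')) :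
    JoinedIn (cayleyDomain ω) X X' := by
  obtain ⟨ε, h0, h1, hε⟩ :=
    exists_joinedIn_smul_smul (joinedIn_skewReg_of_sigPos_eq hAlt hω hX.1 hX'.1 h)
  exact ((joinedIn_smul_of_mem_shrinkable hX h0 h1).trans hε).trans
    (joinedIn_smul_of_mem_shrinkable hX' h0 h1).symm

theorem exists_not_injective_of_det_neg (h : LinearMap.det (1 - X) < 0) :
    ∃ t ∈ Set.Ioo (0 : ℝ) 1, ¬ Function.Injective (1 - t • X : End ℝ H) := by
  have hc : Continuous fun t : ℝ => LinearMap.det (1 - t • X) :=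
    continuous_det_end.comp (by fun_prop)
  obtain ⟨t, ht, ht0⟩ := intermediate_value_Ioo' (zero_le_one' ℝ) hc.continuousOn
    (show (0 : ℝ) ∈ Set.Ioo _ _ by simpa using h)
  exact ⟨t, ht, fun hi => injective_iff_det_ne_zero.1 hi ht0⟩

theorem exists_eigenvector_of_det_neg (h : LinearMap.det (1 - X) < 0) :
    ∃ e ≠ 0, ∃ μ : ℝ, 1 < μ ∧ X e = μ • e := by
  obtain ⟨t, ⟨h0, h1⟩, ht⟩ := exists_not_injective_of_det_neg h
  obtain ⟨e, he, hXe⟩ := exists_eigenvector_of_not_injective h0.ne' ht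
  exact ⟨e, he, t⁻¹, (one_lt_inv₀ h0).2 h1, hXe⟩

theorem det_one_sub_pos_of_mem_shrinkable (hX : X ∈ shrinkable ω) :
    0 < LinearMap.det (1 - X) := by
  refine lt_of_not_ge fun h => ?_
  have hne := injective_iff_det_ne_zero.1 (shrinkable_subset_cayleyDomain hX).2
  obtain ⟨t, ht, hinj⟩ := exists_not_injective_of_det_neg (lt_of_le_of_ne h hne)
  exact hinj (hX.2 t ⟨ht.1, ht.2.le⟩)

theorem exists_joinedIn_extend_of_notMem_shrinkable (hAlt : ω.IsAlt) (hω : ω.Nondegenerate)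
    (hX : X ∈ cayleyDomain ω) (hX' : X ∉ shrinkable ω) :
    ∃ S : PlaneSplitting ω, ∃ Y ∈ cayleyDomain S.form,
      JoinedIn (cayleyDomain ω) X (S.extend 2 Y) := by
  obtain ⟨t, ⟨h0, h1⟩, ht⟩ :
      ∃ t ∈ Set.Ioc (0 : ℝ) 1, ¬ Function.Injective (1 - t • X : End ℝ H) := by
    by_contra! h
    exact hX' ⟨hX.1, h⟩
  have hne : t ≠ 1 := by
    rintro rfl
    exact ht (by simpa only [one_smul] using hX.2)
  obtain ⟨e, he, hXe⟩ := exists_eigenvector_of_not_injective h0.ne' ht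
  obtain ⟨S, hS⟩ := exists_planeSplitting hAlt hω.1 he
  exact ⟨S, S.exists_joinedIn_extend hX hS ((one_lt_inv₀ h0).2 (lt_of_le_of_ne h1 hne)) hXe⟩

/-- Eigenvalue pairs `±μ` with `1 < μ` split off as hyperbolic planes, and two such planes can be
traded for two shrinkable ones, so at most one of them is left. -/
theorem exists_joinedIn_shrinkable_or_extend (hAlt : ω.IsAlt) (hω : ω.Nondegenerate)
    (hX : X ∈ cayleyDomain ω) :
    (∃ X' ∈ shrinkable ω, JoinedIn (cayleyDomain ω) X X') ∨
      ∃ S : PlaneSplitting ω, ∃ Y ∈ shrinkable S.form,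
        JoinedIn (cayleyDomain ω) X (S.extend 2 Y) := by
  induction hd : finrank ℝ H using Nat.strong_induction_on generalizing H with | _ d ih
  by_cases hXs : X ∈ shrinkable ω
  · exact .inl ⟨X, hXs, .refl hX⟩
  obtain ⟨S, Y, hY, hXY⟩ := exists_joinedIn_extend_of_notMem_shrinkable hAlt hω hX hXs
  have hlt : finrank ℝ S.W < d := by
    have := S.finrank_eq
    omega
  rcases ih _ hlt (S.isAlt hAlt) (S.nondegenerate hAlt hω) hY rfl with
    ⟨Y', hY', hYY'⟩ | ⟨T, Z, hZ, hYZ⟩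
  · exact .inr ⟨S, Y', hY', hXY.trans
      (S.joinedIn_extend hYY' (by norm_num) (by norm_num) (by norm_num))⟩
  · have hZs := S.extend_mem_shrinkable
      (T.extend_mem_shrinkable hZ one_half_pos one_half_lt_one) one_half_pos one_half_lt_one
    exact .inl ⟨_, hZs, (hXY.trans
      (S.joinedIn_extend hYZ (by norm_num) (by norm_num) (by norm_num))).trans
      (S.joinedIn_extend_extend T (shrinkable_subset_cayleyDomain hZ))⟩

theorem exists_joinedIn_shrinkable (hAlt : ω.IsAlt) (hω : ω.Nondegenerate)
    (hX : X ∈ cayleyDomain ω) (hdet : 0 < LinearMap.det (1 - X)) :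
    ∃ X' ∈ shrinkable ω, JoinedIn (cayleyDomain ω) X X' := by
  refine (exists_joinedIn_shrinkable_or_extend hAlt hω hX).resolve_right ?_
  rintro ⟨S, Y, hY, hXY⟩
  have h := sign_det_one_sub_eq_of_joinedIn hXY
  rw [S.sign_det_one_sub_extend Y one_lt_two, sign_pos hdet,
    sign_pos (det_one_sub_pos_of_mem_shrinkable hY)] at h
  exact absurd h (by decide)

theorem joinedIn_of_det_pos (hAlt : ω.IsAlt) (hω : ω.Nondegenerate) (hX : X ∈ cayleyDomain ω)
    (hX' : X' ∈ cayleyDomain ω) (hd : 0 < LinearMap.det (1 - X))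
    (hd' : 0 < LinearMap.det (1 - X')) (h : sigPos (skewQuad ω X) = sigPos (skewQuad ω X')) :
    JoinedIn (cayleyDomain ω) X X' := by
  obtain ⟨Y, hY, hXY⟩ := exists_joinedIn_shrinkable hAlt hω hX hd
  obtain ⟨Y', hY', hXY'⟩ := exists_joinedIn_shrinkable hAlt hω hX' hd'
  rw [sigPos_skewQuad_eq_of_joinedIn hAlt hω hXY,
    sigPos_skewQuad_eq_of_joinedIn hAlt hω hXY'] at h
  exact (hXY.trans (joinedIn_of_mem_shrinkable hAlt hω hY hY' h)).trans hXY'.symm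

end Shrinking

section Transvection

attribute [local instance] endTopology isModuleTopology_end isTopologicalRing_end

variable {H : Type*} [AddCommGroup H] [Module ℝ H] {ω : LinearMap.BilinForm ℝ H} {X : End ℝ H}
  {e e' : H} {μ : ℝ}

/-- The symplectic transvection `x ↦ x + c ω(x, u) u`. -/
noncomputable def sympTransvection (ω : LinearMap.BilinForm ℝ H) (u : H) (c : ℝ) : End ℝ H :=
  1 + c • LinearMap.smulRight (ω.flip u) u

theorem sympTransvection_apply (u : H) (c : ℝ) (x : H) :
    sympTransvection ω u c x = x + (c * ω x u) • u := by
  simp [sympTransvection, smul_smul]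

theorem sympTransvection_comp_neg (hAlt : ω.IsAlt) (u : H) (c : ℝ) :
    sympTransvection ω u c ∘ₗ sympTransvection ω u (-c) = LinearMap.id := by
  ext x
  simp [sympTransvection_apply, hAlt u]

/-- The symplectic transvection as a linear equivalence. -/
noncomputable def sympTransvectionEquiv (hAlt : ω.IsAlt) (u : H) (c : ℝ) : H ≃ₗ[ℝ] H :=
  LinearEquiv.ofLinearMap (sympTransvection ω u c) (sympTransvection ω u (-c))
    (sympTransvection_comp_neg hAlt u c) (by simpa using sympTransvection_comp_neg hAlt u (-c))

theorem sympTransvectionEquiv_apply (hAlt : ω.IsAlt) (u : H) (c : ℝ) (x : H) :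
    sympTransvectionEquiv hAlt u c x = x + (c * ω x u) • u :=
  sympTransvection_apply u c x

theorem sympTransvectionEquiv_isometry (hAlt : ω.IsAlt) (u : H) (c : ℝ) (x y : H) :
    ω (sympTransvectionEquiv hAlt u c x) (sympTransvectionEquiv hAlt u c y) = ω x y := by
  simp only [sympTransvectionEquiv_apply, map_add, map_smul, LinearMap.add_apply,
    LinearMap.smul_apply, hAlt u, smul_eq_mul, ← hAlt.neg_eq y u]
  ring

theorem sympTransvectionEquiv_sub_apply (hAlt : ω.IsAlt) (hee' : ω e e' ≠ 0) :
    sympTransvectionEquiv hAlt (e' - e) (ω e e')⁻¹ e = e' := by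
  rw [sympTransvectionEquiv_apply, map_sub, hAlt e, sub_zero, inv_mul_cancel₀ hee', one_smul,
    add_sub_cancel]

theorem exists_apply_ne_zero_and_apply_ne_zero (hω : ω.Nondegenerate) (he : e ≠ 0)
    (he' : e' ≠ 0) : ∃ z, ω e z ≠ 0 ∧ ω z e' ≠ 0 := by
  obtain ⟨z, hz⟩ := Dual.exists_forall_ne_zero_of_forall_exists ![ω e, ω.flip e'] <| by
    refine Fin.forall_fin_two.2 ⟨?_, ?_⟩ <;> by_contra! h
    · exact he (hω.1 e h)
    · exact he' (hω.2 e' h)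
  exact ⟨z, hz 0, hz 1⟩

variable [FiniteDimensional ℝ H]

theorem joinedIn_conj_sympTransvectionEquiv (hAlt : ω.IsAlt) (u : H) (c : ℝ)
    (hX : X ∈ cayleyDomain ω) :
    JoinedIn (cayleyDomain ω) X ((sympTransvectionEquiv hAlt u c).conj X) := by
  have hconj : ∀ c, (sympTransvectionEquiv hAlt u c).conj X =
      sympTransvection ω u c * X * sympTransvection ω u (-c) := fun c => rfl
  refine JoinedIn.ofLine (f := fun t => (sympTransvectionEquiv hAlt u (t * c)).conj X) ?_ ?_
    (by rw [one_mul]) ?_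
  · simp only [hconj, sympTransvection]
    exact Continuous.continuousOn (by fun_prop)
  · simp [hconj, sympTransvection]
  · rintro _ ⟨t, -, rfl⟩
    exact conj_mem_cayleyDomain (sympTransvectionEquiv_isometry hAlt u _) hX

theorem exists_joinedIn_eigenvector_of_apply_ne_zero (hAlt : ω.IsAlt) (hee' : ω e e' ≠ 0)
    (hX : X ∈ cayleyDomain ω) (he : X e = μ • e) :
    ∃ X', JoinedIn (cayleyDomain ω) X X' ∧ X' e' = μ • e' := by
  refine ⟨_, joinedIn_conj_sympTransvectionEquiv hAlt (e' - e) (ω e e')⁻¹ hX, ?_⟩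
  have hφ := sympTransvectionEquiv_sub_apply hAlt hee'
  rw [LinearEquiv.conj_apply_apply, (LinearEquiv.symm_apply_eq _).2 hφ.symm, he, map_smul, hφ]

theorem exists_joinedIn_eigenvector (hAlt : ω.IsAlt) (hω : ω.Nondegenerate) (he0 : e ≠ 0)
    (he0' : e' ≠ 0) (hX : X ∈ cayleyDomain ω) (he : X e = μ • e) :
    ∃ X', JoinedIn (cayleyDomain ω) X X' ∧ X' e' = μ • e' := by
  obtain ⟨z, hz, hz'⟩ := exists_apply_ne_zero_and_apply_ne_zero hω he0 he0'
  obtain ⟨X₁, hXX₁, hX₁⟩ := exists_joinedIn_eigenvector_of_apply_ne_zero hAlt hz hX he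
  obtain ⟨X₂, hX₁X₂, hX₂⟩ :=
    exists_joinedIn_eigenvector_of_apply_ne_zero hAlt hz' hXX₁.target_mem hX₁
  exact ⟨X₂, hXX₁.trans hX₁X₂, hX₂⟩

end Transvection

section PathComponents

attribute [local instance] endTopology isModuleTopology_end isTopologicalRing_end

variable {H : Type*} [AddCommGroup H] [Module ℝ H] [FiniteDimensional ℝ H]
  {ω : LinearMap.BilinForm ℝ H} {X X' : End ℝ H}

theorem exists_joinedIn_extend_of_det_neg (hAlt : ω.IsAlt) (hω : ω.Nondegenerate)
    {S : PlaneSplitting ω} {e : H} (hS : S.equiv e = ((1, 0), 0)) (hX : X ∈ cayleyDomain ω)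
    (hd : LinearMap.det (1 - X) < 0) :
    ∃ Y ∈ cayleyDomain S.form, JoinedIn (cayleyDomain ω) X (S.extend 2 Y) ∧
      0 < LinearMap.det (1 - Y) ∧ sigPos (skewQuad ω X) = sigPos (skewQuad S.form Y) + 1 := by
  have he : e ≠ 0 := by
    rintro rfl
    simp [Prod.ext_iff] at hS
  obtain ⟨e', he', μ, hμ, hXe'⟩ := exists_eigenvector_of_det_neg hd
  obtain ⟨X₁, hXX₁, hX₁⟩ := exists_joinedIn_eigenvector hAlt hω he' he hX hXe'
  obtain ⟨Y, hY, hX₁Y⟩ := S.exists_joinedIn_extend hXX₁.target_mem hS hμ hX₁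
  have hXY := hXX₁.trans hX₁Y
  refine ⟨Y, hY, hXY, ?_, ?_⟩
  · have h := sign_det_one_sub_eq_of_joinedIn hXY
    rw [sign_neg hd, S.sign_det_one_sub_extend Y one_lt_two, neg_inj] at h
    exact sign_eq_one_iff.1 h.symm
  · rw [sigPos_skewQuad_eq_of_joinedIn hAlt hω hXY, S.sigPos_skewQuad_extend Y two_pos]

theorem joinedIn_of_det_neg (hAlt : ω.IsAlt) (hω : ω.Nondegenerate) (hX : X ∈ cayleyDomain ω)
    (hX' : X' ∈ cayleyDomain ω) (hd : LinearMap.det (1 - X) < 0)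
    (hd' : LinearMap.det (1 - X') < 0) (h : sigPos (skewQuad ω X) = sigPos (skewQuad ω X')) :
    JoinedIn (cayleyDomain ω) X X' := by
  obtain ⟨e, he, -⟩ := exists_eigenvector_of_det_neg hd
  obtain ⟨S, hS⟩ := exists_planeSplitting hAlt hω.1 he
  obtain ⟨Y, hY, hXY, hYd, hYs⟩ := exists_joinedIn_extend_of_det_neg hAlt hω hS hX hd
  obtain ⟨Y', hY', hXY', hYd', hYs'⟩ := exists_joinedIn_extend_of_det_neg hAlt hω hS hX' hd'
  have hYY' := joinedIn_of_det_pos (S.isAlt hAlt) (S.nondegenerate hAlt hω) hY hY' hYd hYd'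
    (by omega)
  exact (hXY.trans (S.joinedIn_extend hYY' two_ne_zero (by norm_num) (by norm_num))).trans
    hXY'.symm

theorem joinedIn_cayleyDomain (hAlt : ω.IsAlt) (hω : ω.Nondegenerate) (hX : X ∈ cayleyDomain ω)
    (hX' : X' ∈ cayleyDomain ω)
    (hd : SignType.sign (LinearMap.det (1 - X)) = SignType.sign (LinearMap.det (1 - X')))
    (h : sigPos (skewQuad ω X) = sigPos (skewQuad ω X')) : JoinedIn (cayleyDomain ω) X X' := by
  rcases (injective_iff_det_ne_zero.1 hX.2).lt_or_gt with hneg | hpos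
  · rw [sign_neg hneg, eq_comm, sign_eq_neg_one_iff] at hd
    exact joinedIn_of_det_neg hAlt hω hX hX' hneg hd h
  · rw [sign_pos hpos, eq_comm, sign_eq_one_iff] at hd
    exact joinedIn_of_det_pos hAlt hω hX hX' hpos hd h

end PathComponents

section Realization

attribute [local instance] endTopology isModuleTopology_end isTopologicalRing_end

theorem exists_quadraticForm_sigPos_eq {V : Type*} [AddCommGroup V] [Module ℝ V]
    [FiniteDimensional ℝ V] {p : ℕ} (hp : p ≤ finrank ℝ V) :
    ∃ Q : QuadraticForm ℝ V, Q.radical = ⊥ ∧ sigPos Q = p := by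
  let w : Fin (finrank ℝ V) → ℝ := fun i => if (i : ℕ) < p then 1 else -1
  have hw : ∀ i, w i ≠ 0 := fun i => by
    simp only [w]
    split_ifs <;> norm_num
  have hpos : {i | 0 < w i} = {i : Fin (finrank ℝ V) | (i : ℕ) < p} := by
    ext i
    by_cases hi : (i : ℕ) < p <;> simp [w, hi]
  let Q := (QuadraticMap.weightedSumSquares ℝ w).comp (finBasis ℝ V).equivFun.toLinearMap
  have hQ : QuadraticMap.Equivalent Q (QuadraticMap.weightedSumSquares ℝ w) :=
    ⟨⟨(finBasis ℝ V).equivFun, fun _ => rfl⟩⟩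
  refine ⟨Q, ?_, ?_⟩
  · rw [← Submodule.finrank_eq_zero, QuadraticForm.finrank_radical_of_equiv_weightedSumSquares hQ]
    simp [hw]
  · rw [QuadraticForm.sigPos_of_equiv_weightedSumSquares hQ, hpos, Set.ncard_eq_toFinset_card',
      Set.toFinset_ofPred, Fin.card_filter_val_lt, min_eq_right hp]

theorem sigPos_smul {V : Type*} [AddCommGroup V] [Module ℝ V] (Q : QuadraticForm ℝ V) {c : ℝ}
    (hc : 0 < c) : sigPos (c • Q) = sigPos Q := by
  refine QuadraticMap.Equivalent.sigPos_eq
    ⟨⟨LinearEquiv.smulOfNeZero ℝ V (√c) (Real.sqrt_pos.2 hc).ne', fun x => ?_⟩⟩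
  change Q (√c • x) = c • Q x
  rw [QuadraticMap.map_smul, Real.mul_self_sqrt hc.le]

variable {H : Type*} [AddCommGroup H] [Module ℝ H] {ω : LinearMap.BilinForm ℝ H} {X : End ℝ H}
  {p : ℕ}

theorem injective_of_radical_skewQuad_eq_bot (hAlt : ω.IsAlt) (hX : X ∈ skewEnd ω)
    (h : (skewQuad ω X).radical = ⊥) : Function.Injective X := by
  rw [QuadraticMap.radical_eq_ker_associated, associated_skewQuad hAlt hX,
    LinearMap.ker_eq_bot] at h
  exact Function.Injective.of_comp (f := ω) h

variable [FiniteDimensional ℝ H]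

theorem exists_mem_skewEnd_skewQuad_eq (hAlt : ω.IsAlt) (hω : ω.Nondegenerate)
    (Q : QuadraticForm ℝ H) : ∃ X ∈ skewEnd ω, skewQuad ω X = Q := by
  let X := LinearMap.BilinForm.symmCompOfNondegenerate (QuadraticMap.associated (R := ℝ) Q) ω hω
  have hX : ∀ x y, ω (X x) y = QuadraticMap.associated (R := ℝ) Q x y := fun x y =>
    LinearMap.BilinForm.symmCompOfNondegenerate_left_apply _ hω y x
  refine ⟨X, fun x y => ?_, QuadraticMap.ext fun x => ?_⟩
  · rw [hAlt.neg_eq x, hX, hX]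
    exact QuadraticMap.associated_isSymm ℝ Q x y
  · rw [skewQuad_apply, hX, QuadraticMap.associated_eq_self_apply]

theorem exists_mem_skewReg_sigPos_eq (hAlt : ω.IsAlt) (hω : ω.Nondegenerate)
    (hp : p ≤ finrank ℝ H) : ∃ X ∈ skewReg ω, sigPos (skewQuad ω X) = p := by
  obtain ⟨Q, hQ, rfl⟩ := exists_quadraticForm_sigPos_eq hp
  obtain ⟨X, hX, rfl⟩ := exists_mem_skewEnd_skewQuad_eq hAlt hω Q
  exact ⟨X, ⟨hX, injective_of_radical_skewQuad_eq_bot hAlt hX hQ⟩, rfl⟩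

theorem exists_sigPos_eq_of_det_pos (hAlt : ω.IsAlt) (hω : ω.Nondegenerate)
    (hp : p ≤ finrank ℝ H) :
    ∃ X ∈ cayleyDomain ω, 0 < LinearMap.det (1 - X) ∧ sigPos (skewQuad ω X) = p := by
  obtain ⟨X, hX, hXp⟩ := exists_mem_skewReg_sigPos_eq hAlt hω hp
  obtain ⟨ε, hdet, hε⟩ :=
    ((eventually_det_one_sub_smul_pos X).and self_mem_nhdsWithin).exists
  have hsmul : skewQuad ω (ε • X) = ε • skewQuad ω X := by
    ext x
    simp
  exact ⟨ε • X, ⟨smul_mem_skewReg hX (ne_of_gt hε), injective_iff_det_ne_zero.2 hdet.ne'⟩, hdet,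
    by rw [hsmul, sigPos_smul _ hε, hXp]⟩

theorem exists_sigPos_eq_of_det_neg (hAlt : ω.IsAlt) (hω : ω.Nondegenerate) (hp0 : 0 < p)
    (hp : p < finrank ℝ H) :
    ∃ X ∈ cayleyDomain ω, LinearMap.det (1 - X) < 0 ∧ sigPos (skewQuad ω X) = p := by
  have : Nontrivial H := Module.nontrivial_of_finrank_pos (R := ℝ) (by omega)
  obtain ⟨e, he⟩ := exists_ne (0 : H)
  obtain ⟨S, -⟩ := exists_planeSplitting hAlt hω.1 he
  have hS := S.finrank_eq
  obtain ⟨Y, hY, hYd, hYp⟩ := exists_sigPos_eq_of_det_pos (S.isAlt hAlt) (S.nondegenerate hAlt hω)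
    (p := p - 1) (by omega)
  refine ⟨S.extend 2 Y, S.extend_mem_cayleyDomain hY two_ne_zero (by norm_num) (by norm_num), ?_,
    ?_⟩
  · rw [← sign_eq_neg_one_iff, S.sign_det_one_sub_extend Y one_lt_two, sign_pos hYd]
  · rw [S.sigPos_skewQuad_extend Y two_pos, hYp, Nat.sub_add_cancel hp0]

theorem sigPos_lt_finrank_of_apply_eq_zero {V : Type*} [AddCommGroup V] [Module ℝ V]
    [FiniteDimensional ℝ V] {Q : QuadraticForm ℝ V} {v : V} (hv : v ≠ 0) (hQ : Q v = 0) :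
    sigPos Q < finrank ℝ V := by
  have h := QuadraticForm.sigPos_add_finrank_le_of_nonpos (Q := Q)
    (V := Submodule.span ℝ {v}) fun x hx => by
      obtain ⟨c, rfl⟩ := Submodule.mem_span_singleton.1 hx
      rw [QuadraticMap.map_smul, hQ, smul_zero]
  rw [finrank_span_singleton hv] at h
  omega

theorem sigPos_skewQuad_mem_Ioo_of_det_neg (hAlt : ω.IsAlt) (hω : ω.Nondegenerate)
    (hX : X ∈ skewReg ω) (hd : LinearMap.det (1 - X) < 0) :
    sigPos (skewQuad ω X) ∈ Set.Ioo 0 (finrank ℝ H) := by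
  obtain ⟨e, he, μ, -, hXe⟩ := exists_eigenvector_of_det_neg hd
  have hQe : skewQuad ω X e = 0 := by simp [hXe, hAlt e]
  have hneg : sigNeg (skewQuad ω X) < finrank ℝ H := by
    rw [← sigPos_neg]
    exact sigPos_lt_finrank_of_apply_eq_zero he (by simp [hQe])
  have hsum := sigPos_add_sigNeg_skewQuad hAlt hω hX
  exact ⟨by omega, sigPos_lt_finrank_of_apply_eq_zero he hQe⟩

theorem exists_sign_det_eq_and_sigPos_eq_iff (hAlt : ω.IsAlt) (hω : ω.Nondegenerate)
    {s : SignType} :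
    (∃ X ∈ cayleyDomain ω,
        SignType.sign (LinearMap.det (1 - X)) = s ∧ sigPos (skewQuad ω X) = p) ↔
      s = 1 ∧ p ≤ finrank ℝ H ∨ s = -1 ∧ p ∈ Set.Ioo 0 (finrank ℝ H) := by
  constructor
  · rintro ⟨X, hX, rfl, rfl⟩
    rcases (injective_iff_det_ne_zero.1 hX.2).lt_or_gt with hd | hd
    · exact .inr ⟨sign_neg hd, sigPos_skewQuad_mem_Ioo_of_det_neg hAlt hω hX.1 hd⟩
    · exact .inl ⟨sign_pos hd, sigPos_le_finrank _⟩
  · rintro (⟨rfl, hp⟩ | ⟨rfl, hp0, hp⟩)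
    · obtain ⟨X, hX, hd, hXp⟩ := exists_sigPos_eq_of_det_pos hAlt hω hp
      exact ⟨X, hX, sign_pos hd, hXp⟩
    · obtain ⟨X, hX, hd, hXp⟩ := exists_sigPos_eq_of_det_neg hAlt hω hp0 hp
      exact ⟨X, hX, sign_neg hd, hXp⟩

end Realization

section SpStarStar

attribute [local instance] endTopology isModuleTopology_end isTopologicalRing_end

variable {H : Type*} [AddCommGroup H] [Module ℝ H] [FiniteDimensional ℝ H]
  {ω : LinearMap.BilinForm ℝ H} {n : ℕ}

theorem injective_one_sub (A : SpStarStar ω) : Function.Injective (1 - A.1 : End ℝ H) := by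
  simpa only [notMem_spectrum_iff, one_smul] using A.2.2.1

/-- The Cayley transform as a homeomorphism onto `Sp^{**}(H)`. -/
noncomputable def cayleyHomeomorph (ω : LinearMap.BilinForm ℝ H) :
    cayleyDomain ω ≃ₜ SpStarStar ω where
  toFun X := ⟨cayley X.1, cayley_mem_Sp X.2, one_notMem_spectrum_cayley X.2,
    neg_one_notMem_spectrum_cayley X.2⟩
  invFun A := ⟨cayley A.1, cayley_mem_cayleyDomain A⟩
  left_inv X := Subtype.ext (cayley_cayley X.2.2)
  right_inv A := Subtype.ext (cayley_cayley (injective_one_sub A))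
  continuous_toFun := continuous_induced_rng.2
    (continuousOn_cayley.comp_continuous continuous_subtype_val fun X => X.2.2)
  continuous_invFun := Continuous.subtype_mk
    (continuousOn_cayley.comp_continuous continuous_induced_dom injective_one_sub) _

theorem sign_det_one_sub_cayleyHomeomorph (X : cayleyDomain ω) :
    SignType.sign (LinearMap.det (1 - (cayleyHomeomorph ω X).1)) =
      SignType.sign (LinearMap.det (1 - X.1)) :=
  sign_det_one_sub_cayley X.2.2

theorem kreinIndex_cayleyHomeomorph (hAlt : ω.IsAlt) (hω : ω.Nondegenerate)
    (hn : finrank ℝ H = 2 * n) (X : cayleyDomain ω) :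
    kreinIndex ω (cayleyHomeomorph ω X).1 = (sigPos (skewQuad ω X.1) : ℤ) - n := by
  have hκ : 2 * kreinIndex ω (cayleyHomeomorph ω X).1 = _ := two_mul_kreinIndex_cayley hAlt hω X.2
  have hsum := sigPos_add_sigNeg_skewQuad hAlt hω X.2.1
  omega

theorem continuous_sign_det_kreinIndex (hAlt : ω.IsAlt) (hω : ω.Nondegenerate)
    (hn : finrank ℝ H = 2 * n) :
    Continuous fun A : SpStarStar ω =>
      (SignType.sign (LinearMap.det (1 - A.1)), kreinIndex ω A.1) := by
  rw [← (cayleyHomeomorph ω).comp_continuous_iff']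
  simp only [Function.comp_def, sign_det_one_sub_cayleyHomeomorph,
    kreinIndex_cayleyHomeomorph hAlt hω hn]
  exact isLocallyConstant_sign_det_one_sub.continuous.prodMk
    ((isLocallyConstant_sigPos_skewQuad hAlt hω).comp fun p : ℕ => (p : ℤ) - n).continuous

theorem connectedComponents_mk_eq (hAlt : ω.IsAlt) (hω : ω.Nondegenerate)
    (hn : finrank ℝ H = 2 * n) {A B : SpStarStar ω}
    (hd : SignType.sign (LinearMap.det (1 - A.1)) = SignType.sign (LinearMap.det (1 - B.1)))
    (hκ : kreinIndex ω A.1 = kreinIndex ω B.1) :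
    ConnectedComponents.mk A = ConnectedComponents.mk B := by
  obtain ⟨X, rfl⟩ := (cayleyHomeomorph ω).surjective A
  obtain ⟨Y, rfl⟩ := (cayleyHomeomorph ω).surjective B
  rw [sign_det_one_sub_cayleyHomeomorph, sign_det_one_sub_cayleyHomeomorph] at hd
  rw [kreinIndex_cayleyHomeomorph hAlt hω hn, kreinIndex_cayleyHomeomorph hAlt hω hn, sub_left_inj,
    Nat.cast_inj] at hκ
  have hXY := (joinedIn_cayleyDomain hAlt hω X.2 Y.2 hd hκ).joined_subtype
  exact ConnectedComponents.coe_eq_coe'.2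
    (pathComponent_subset_component _ (hXY.map (cayleyHomeomorph ω).continuous).symm)

theorem exists_sign_det_eq_and_kreinIndex_eq_iff (hAlt : ω.IsAlt) (hω : ω.Nondegenerate)
    (hn : finrank ℝ H = 2 * n) {s : SignType} {k : ℤ} :
    (∃ A : SpStarStar ω,
        SignType.sign (LinearMap.det (1 - A.1)) = s ∧ kreinIndex ω A.1 = k) ↔
      s = 1 ∧ |k| ≤ n ∨ s = -1 ∧ |k| ≤ (n : ℤ) - 1 := by
  have hX := fun p => exists_sign_det_eq_and_sigPos_eq_iff hAlt hω (p := p) (s := s)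
  rw [(cayleyHomeomorph ω).surjective.exists]
  simp only [sign_det_one_sub_cayleyHomeomorph, kreinIndex_cayleyHomeomorph hAlt hω hn, abs_le]
  constructor
  · rintro ⟨X, hd, hk⟩
    have h := (hX _).1 ⟨X, X.2, hd, rfl⟩
    exact h.imp (fun ⟨hs, _⟩ => ⟨hs, by omega⟩)
      (fun ⟨hs, _, _⟩ => ⟨hs, by omega⟩)
  · intro h
    obtain ⟨X, hXd, hd, hp⟩ := (hX (n + k).toNat).2
      (h.imp (fun ⟨hs, _⟩ => ⟨hs, by omega⟩) (fun ⟨hs, _⟩ => ⟨hs, by omega, by omega⟩))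
    refine ⟨⟨X, hXd⟩, hd, ?_⟩
    change (sigPos (skewQuad ω X) : ℤ) - n = k
    omega

end SpStarStar

theorem lemma4p3 {H : Type*} [AddCommGroup H] [Module ℝ H] [FiniteDimensional ℝ H]
    (ω : LinearMap.BilinForm ℝ H) (hAlt : ω.IsAlt) (hNondeg : ω.Nondegenerate)
    (n : ℕ) (hn : Module.finrank ℝ H = 2 * n) :
    ∃ f : ConnectedComponents (SpStarStar ω) → SignType × ℤ,
      (∀ A : SpStarStar ω,
        f (ConnectedComponents.mk A) =
          (SignType.sign (LinearMap.det (1 - A.1)), kreinIndex ω A.1)) ∧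
      Function.Injective f ∧
      Set.range f =
        {p : SignType × ℤ | (p.1 = 1 ∧ |p.2| ≤ (n : ℤ)) ∨ (p.1 = -1 ∧ |p.2| ≤ (n : ℤ) - 1)} := by
  refine ⟨(continuous_sign_det_kreinIndex hAlt hNondeg hn).connectedComponentsLift, fun A => rfl,
    ConnectedComponents.surjective_coe.forall₂.2 fun A B h => ?_, ?_⟩
  · obtain ⟨hd, hκ⟩ := Prod.mk.inj h
    exact connectedComponents_mk_eq hAlt hNondeg hn hd hκ
  · rw [← ConnectedComponents.surjective_coe.range_comp,
      Continuous.connectedComponentsLift_comp_coe]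
    ext ⟨s, k⟩
    simp only [Set.mem_range, Prod.mk.injEq]
    exact exists_sign_det_eq_and_kreinIndex_eq_iff hAlt hNondeg hn
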